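/- Let $G$ be a finite group. For a commutative ring $R$ with an action of $G$ by ring automorphisms, let $\mathrm{FP}(R)$ be the fixed-point $G$-Tambara functor: $\mathrm{FP}(R)(G/H)=R^H$ for $H\le G$, restrictions are inclusions, conjugations are given by the $G$-action, and for $K\le H$ the transfer and norm are $\mathrm{tr}_K^H(x)=\sum_{hK\in H/K}h x$ and $\mathrm{nm}_K^H(x)=\prod_{hK\in H/K}h x$. An ideal of a Tambara functor $T$ is a family of ideals $I(G/H)\subseteq T(G/H)$ closed under transfer, norm, restriction and conjugation; $IJ$ is the ideal generated by the products $I(G/H)J(G/H)$; an ideal $P\neq T$ is prime if $IJ\subseteq P$ implies $I\subseteq P$ or $J\subseteq P$. The Nakaoka spectrum $\mathrm{Spec}(T)$ is the set of prime ideals of $T$, ordered by inclusion, with the topology whose closed sets are the sets $V(I)=\{P : I\subseteq P\}$, $I$ an ideal of $T$. A $G$-prime ideal of $R$ is a $G$-invariant ideal $\mathfrak q\ne R$ such that, if $x\,(g y)\in\mathfrak q$ for all $g\in G$, then $x\in\mathfrak q$ or $y\in\mathfrak q$; $\mathrm{Spec}_G(R)$ is the poset of these under inclusion. $\mathrm{Spec}(R)/G$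 is the orbit space of $\mathrm{Spec}(R)$ with the quotient topology, ordered by $[\mathfrak p]\le[\mathfrak q]$ if $\mathfrak p\subseteq g\mathfrak q$ for some $g\in G$. Then: (1) There are isomorphisms of posets $$\mathrm{Spec}(R)/G\xrightarrow{\ \varphi\ }\mathrm{Spec}_G(R)\xrightarrow{\ \psi\ }\mathrm{Spec}(R^G),\qquad \delta:\mathrm{Spec}(\mathrm{FP}(R))\to\mathrm{Spec}_G(R),$$ given by $\varphi([\mathfrak p])=\bigcap_{g\in G}g\mathfrak p$, $\psi(\mathfrak q)=\mathfrak q\cap R^G$ and $\delta(P)=P(G/e)$. (2) The resulting bijection $\alpha_R=\psi\circ\delta:\mathrm{Spec}(\mathrm{FP}(R))\to\mathrm{Spec}(R^G)$ is given by $P\mapsto P(G/G)$ and is a homeomorphism, and $\gamma_R=\psi\circ\varphi:\mathrm{Spec}(R)/G\to\mathrm{Spec}(R^G)$, $[\mathfrak p]\mapsto\mathfrak p\cap R^G$, is a homeomorphism as well. Hence $\mathrm{Spec}(\mathrm{FP}(R))\cong\mathrm{Spec}(R)/G\cong\mathrm{Spec}(R^G)$. (3) These homeomorphisms are natural: for every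 $G$-equivariant ring homomorphism $f:R\to S$ of commutative rings with $G$-action, levelwise preimage along $f$ defines a continuous map $\mathrm{Spec}(\mathrm{FP}(S))\to\mathrm{Spec}(\mathrm{FP}(R))$, and $\alpha$ and $\gamma$ commute with the maps on $\mathrm{Spec}(\mathrm{FP}(-))$, $\mathrm{Spec}(-)/G$ and $\mathrm{Spec}((-)^G)$ induced by $f$. -/

import Mathlib

universe u v w

/-! ## Finite `G`-sets: pullback squares and exponential diagrams -/

/-- The square with `a : W → X`, `b : W → Z`, `f : X → Y`, `h : Z → Y` commutes and is a pullback
square: `W` is identified with the set of pairs `(x, z)` such that `f x = h z`. -/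
def IsPullbackSquare {W X Y Z : Type*} (a : W → X) (b : W → Z) (f : X → Y) (h : Z → Y) : Prop :=
  (∀ w, f (a w) = h (b w)) ∧ ∀ x z, f x = h z → ∃! w, a w = x ∧ b w = z

/-- The exponential diagram
`X ←p- A ←e- E -g'→ P -q→ Y` generated by `p : A → X` and `g : X → Y`.
The square formed by `π : E → X`, `g' : E → P`, `g : X → Y`, `q : P → Y` is a pullback square
(`E = X ×_Y P`), `p ∘ e = π`, and `P` is the dependent product of `p` along `g`: sending
`t ∈ P` to `e` restricted to the fibre of `g'` over `t` identifies the fibre of `q` over `y`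
with the set of sections of `p` over the fibre of `g` over `y`. -/
def IsExponentialDiagram {A X Y E P : Type*} (p : A → X) (g : X → Y)
    (e : E → A) (π : E → X) (g' : E → P) (q : P → Y) : Prop :=
  IsPullbackSquare π g' g q ∧ (∀ z, p (e z) = π z) ∧
    ∀ (y : Y) (s : {x // g x = y} → A), (∀ x, p (s x) = x) →
      ∃! t : P, q t = y ∧ ∀ (z : E) (hz : g (π z) = y), g' z = t → e z = s ⟨π z, hz⟩

/-! ## Tambara functors -/

/-- A `G`-Tambara functor, as a family of commutative rings `T(X)` indexed by finite `G`-sets with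
restrictions, transfers and norms along all equivariant maps. Restriction is contravariant and
takes disjoint unions to products, transfer and norm are covariant, both satisfy base change along
pullback squares, and norms distribute over transfers along exponential diagrams. -/
structure TambaraFunctor (G : Type u) [Group G] where
  obj : ∀ (X : Type u) [MulAction G X] [Finite X], Type v
  [commRing : ∀ (X : Type u) [MulAction G X] [Finite X], CommRing (obj X)]
  /-- restriction along `f` -/
  res : ∀ {X Y : Type u} [MulAction G X] [Finite X] [MulAction G Y] [Finite Y],
    (X →[G] Y) → (obj Y →+* obj X)
  /-- transfer along `f` -/
  tr : ∀ {X Y : Type u} [MulAction G X] [Finite X] [MulAction G Y] [Finite Y],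
    (X →[G] Y) → (obj X →+ obj Y)
  /-- norm along `f` -/
  nm : ∀ {X Y : Type u} [MulAction G X] [Finite X] [MulAction G Y] [Finite Y],
    (X →[G] Y) → (obj X →* obj Y)
  res_id : ∀ {X : Type u} [MulAction G X] [Finite X] (a : obj X),
    res (MulActionHom.id G (X := X)) a = a
  tr_id : ∀ {X : Type u} [MulAction G X] [Finite X] (a : obj X),
    tr (MulActionHom.id G (X := X)) a = a
  nm_id : ∀ {X : Type u} [MulAction G X] [Finite X] (a : obj X),
    nm (MulActionHom.id G (X := X)) a = a
  res_comp : ∀ {X Y Z : Type u} [MulAction G X] [Finite X] [MulAction G Y] [Finite Y]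
    [MulAction G Z] [Finite Z] (h : Y →[G] Z) (f : X →[G] Y) (a : obj Z),
    res (h.comp f) a = res f (res h a)
  tr_comp : ∀ {X Y Z : Type u} [MulAction G X] [Finite X] [MulAction G Y] [Finite Y]
    [MulAction G Z] [Finite Z] (h : Y →[G] Z) (f : X →[G] Y) (a : obj X),
    tr (h.comp f) a = tr h (tr f a)
  nm_comp : ∀ {X Y Z : Type u} [MulAction G X] [Finite X] [MulAction G Y] [Finite Y]
    [MulAction G Z] [Finite Z] (h : Y →[G] Z) (f : X →[G] Y) (a : obj X),
    nm (h.comp f) a = nm h (nm f a)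
  obj_empty : ∀ (X : Type u) [MulAction G X] [Finite X], IsEmpty X → Subsingleton (obj X)
  obj_sum : ∀ {X Y Z : Type u} [MulAction G X] [Finite X] [MulAction G Y] [Finite Y]
    [MulAction G Z] [Finite Z] (i : X →[G] Z) (j : Y →[G] Z),
    Function.Bijective (Sum.elim i j) →
      Function.Bijective (fun a : obj Z => (res i a, res j a))
  res_tr : ∀ {W X Y Z : Type u} [MulAction G W] [Finite W] [MulAction G X] [Finite X]
    [MulAction G Y] [Finite Y] [MulAction G Z] [Finite Z]
    (a : W →[G] X) (b : W →[G] Z) (f : X →[G] Y) (h : Z →[G] Y),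
    IsPullbackSquare a b f h → ∀ x : obj X, res h (tr f x) = tr b (res a x)
  res_nm : ∀ {W X Y Z : Type u} [MulAction G W] [Finite W] [MulAction G X] [Finite X]
    [MulAction G Y] [Finite Y] [MulAction G Z] [Finite Z]
    (a : W →[G] X) (b : W →[G] Z) (f : X →[G] Y) (h : Z →[G] Y),
    IsPullbackSquare a b f h → ∀ x : obj X, res h (nm f x) = nm b (res a x)
  nm_tr : ∀ {A X Y E P : Type u} [MulAction G A] [Finite A] [MulAction G X] [Finite X]
    [MulAction G Y] [Finite Y] [MulAction G E] [Finite E] [MulAction G P] [Finite P]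
    (p : A →[G] X) (g : X →[G] Y) (e : E →[G] A) (π : E →[G] X) (g' : E →[G] P) (q : P →[G] Y),
    IsExponentialDiagram p g e π g' q →
      ∀ a : obj A, nm g (tr p a) = tr q (nm g' (res e a))

attribute [instance] TambaraFunctor.commRing

/-! ## The maps between orbits -/

section Orbits

variable {G : Type u} [Group G]

/-- The projection `G/K → G/H`, `gK ↦ gH`, for `K ≤ H`. -/
def orbitProj {K H : Subgroup G} (h : K ≤ H) : (G ⧸ K) →[G] (G ⧸ H) where
  toFun := Subgroup.quotientMapOfLE h
  map_smul' g x := by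
    induction x using QuotientGroup.induction_on with
    | H x => rfl

/-- The conjugate subgroup `gHg⁻¹`. -/
abbrev conjSubgroup (g : G) (H : Subgroup G) : Subgroup G := H.map (MulAut.conj g).toMonoidHom

/-- The equivariant bijection `G/gHg⁻¹ → G/H` that sends the identity coset to `gH`. -/
def orbitConj (g : G) (H : Subgroup G) : (G ⧸ conjSubgroup g H) →[G] (G ⧸ H) where
  toFun := Quotient.map' (fun x => x * g) (by
    intro x y hxy
    rw [QuotientGroup.leftRel_apply] at hxy ⊢
    obtain ⟨k, hk, hk'⟩ := hxy
    have : k = (x * g)⁻¹ * (y * g) := by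
      have h2 : g * k * g⁻¹ = x⁻¹ * y := by simpa using hk'
      have h3 : k = g⁻¹ * (g * k * g⁻¹) * g := by group
      rw [h3, h2]; group
    exact this ▸ hk)
  map_smul' g' x := by
    induction x using QuotientGroup.induction_on with
    | H x =>
      change (QuotientGroup.mk _ : G ⧸ H) = QuotientGroup.mk _
      simp [mul_assoc]

end Orbits

namespace TambaraFunctor

variable {G : Type u} [Group G] [Finite G] (T : TambaraFunctor.{u, v} G)

/-- The level `T(G/H)`. -/
abbrev level (H : Subgroup G) : Type v := T.obj (G ⧸ H)

/-- `res^H_K : T(G/H) → T(G/K)`. -/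
def levelRes {K H : Subgroup G} (h : K ≤ H) : T.level H →+* T.level K := T.res (orbitProj h)

/-- `tr_K^H : T(G/K) → T(G/H)`. -/
def levelTr {K H : Subgroup G} (h : K ≤ H) : T.level K →+ T.level H := T.tr (orbitProj h)

/-- `nm_K^H : T(G/K) → T(G/H)`. -/
def levelNm {K H : Subgroup G} (h : K ≤ H) : T.level K →* T.level H := T.nm (orbitProj h)

/-- The conjugation `T(G/H) → T(G/gHg⁻¹)`. -/
def levelConj (g : G) (H : Subgroup G) : T.level H →+* T.level (conjSubgroup g H) :=
  T.res (orbitConj g H)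

end TambaraFunctor

/-! ## Ideals, prime ideals and the Nakaoka spectrum -/

/-- An ideal of a Tambara functor: a levelwise collection of ideals that is closed under transfer,
norm, restriction and conjugation. -/
@[ext]
structure TambaraIdeal {G : Type u} [Group G] [Finite G] (T : TambaraFunctor.{u, v} G) where
  level : ∀ H : Subgroup G, Ideal (T.level H)
  tr_mem : ∀ {K H : Subgroup G} (h : K ≤ H) (a : T.level K),
    a ∈ level K → T.levelTr h a ∈ level H
  nm_mem : ∀ {K H : Subgroup G} (h : K ≤ H) (a : T.level K),
    a ∈ level K → T.levelNm h a ∈ level H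
  res_mem : ∀ {K H : Subgroup G} (h : K ≤ H) (a : T.level H),
    a ∈ level H → T.levelRes h a ∈ level K
  conj_mem : ∀ (g : G) (H : Subgroup G) (a : T.level H),
    a ∈ level H → T.levelConj g H a ∈ level (conjSubgroup g H)

namespace TambaraIdeal

variable {G : Type u} [Group G] [Finite G] {T : TambaraFunctor.{u, v} G}

/-- Levelwise inclusion of ideals. -/
instance : PartialOrder (TambaraIdeal T) := PartialOrder.lift level fun _ _ => TambaraIdeal.ext

/-- The whole Tambara functor as an ideal of itself. -/
instance : Top (TambaraIdeal T) where
  top := ⟨fun _ => ⊤, by simp, by simp, by simp, by simp⟩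

/-- The ideal generated by a levelwise collection of subsets: the intersection of all ideals that
contain it. -/
def span (S : ∀ H : Subgroup G, Set (T.level H)) : TambaraIdeal T where
  level H := ⨅ I : {I : TambaraIdeal T // ∀ H, S H ⊆ I.level H}, I.1.level H
  tr_mem h a ha := by
    simp only [Submodule.mem_iInf] at ha ⊢
    exact fun I => I.1.tr_mem h a (ha I)
  nm_mem h a ha := by
    simp only [Submodule.mem_iInf] at ha ⊢
    exact fun I => I.1.nm_mem h a (ha I)
  res_mem h a ha := by
    simp only [Submodule.mem_iInf] at ha ⊢
    exact fun I => I.1.res_mem h a (ha I)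
  conj_mem g H a ha := by
    simp only [Submodule.mem_iInf] at ha ⊢
    exact fun I => I.1.conj_mem g H a (ha I)

/-- The product `IJ`: the ideal generated by the levelwise products `I(G/H)J(G/H)`. -/
instance : Mul (TambaraIdeal T) where
  mul I J := span fun H => ((I.level H * J.level H : Ideal (T.level H)) : Set (T.level H))

/-- `P` is prime: it is proper, and `IJ ⊆ P` implies `I ⊆ P` or `J ⊆ P`. -/
def IsPrime (P : TambaraIdeal T) : Prop :=
  P ≠ ⊤ ∧ ∀ I J : TambaraIdeal T, I * J ≤ P → I ≤ P ∨ J ≤ P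

theorem span_le {S : ∀ H : Subgroup G, Set (T.level H)} {I : TambaraIdeal T} :
    span S ≤ I ↔ ∀ H, S H ⊆ I.level H := by
  constructor
  · intro h H a ha
    refine h H ?_
    change a ∈ ⨅ I : {I : TambaraIdeal T // ∀ H, S H ⊆ I.level H}, I.1.level H
    simp only [Submodule.mem_iInf]
    exact fun J => J.2 H ha
  · intro h H
    exact iInf_le (fun I : {I : TambaraIdeal T // ∀ H, S H ⊆ I.level H} => I.1.level H) ⟨I, h⟩

theorem mul_le_left (I J : TambaraIdeal T) : I * J ≤ I :=
  span_le.2 fun _ => SetLike.coe_subset_coe.2 Ideal.mul_le_left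

theorem mul_le_right (I J : TambaraIdeal T) : I * J ≤ J :=
  span_le.2 fun _ => SetLike.coe_subset_coe.2 Ideal.mul_le_right

end TambaraIdeal

/-- The set of prime ideals of a Tambara functor. -/
@[ext]
structure NakaokaSpectrum {G : Type u} [Group G] [Finite G] (T : TambaraFunctor.{u, v} G) where
  ideal : TambaraIdeal T
  isPrime : ideal.IsPrime

namespace NakaokaSpectrum

variable {G : Type u} [Group G] [Finite G] {T : TambaraFunctor.{u, v} G}

/-- Inclusion of prime ideals. -/
instance : PartialOrder (NakaokaSpectrum T) :=
  PartialOrder.lift ideal fun _ _ => NakaokaSpectrum.ext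

/-- `V(I)`, the set of primes that contain `I`. -/
def zeroLocus (I : TambaraIdeal T) : Set (NakaokaSpectrum T) := {P | I ≤ P.ideal}

/-- The Zariski topology: the closed sets are the sets `V(I)`. -/
instance : TopologicalSpace (NakaokaSpectrum T) :=
  TopologicalSpace.ofClosed (Set.range zeroLocus)
    ⟨⊤, Set.eq_empty_iff_forall_notMem.2 fun P hP => P.isPrime.1 (le_antisymm (fun _ => le_top) hP)⟩
    (by
      intro A hA
      refine ⟨TambaraIdeal.span fun H =>
        ⋃ I ∈ {I : TambaraIdeal T | zeroLocus I ∈ A}, (I.level H : Set (T.level H)), ?_⟩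
      ext P
      simp only [zeroLocus, Set.mem_ofPred_eq, TambaraIdeal.span_le, Set.iUnion_subset_iff,
        Set.mem_sInter]
      constructor
      · intro h V hV
        obtain ⟨I, rfl⟩ := hA hV
        exact fun H => h H I hV
      · intro h H I hI
        exact h _ hI H)
    (by
      rintro _ ⟨I, rfl⟩ _ ⟨J, rfl⟩
      refine ⟨I * J, ?_⟩
      ext P
      refine ⟨fun h => P.isPrime.2 I J h, ?_⟩
      rintro (h | h)
      · exact (TambaraIdeal.mul_le_left I J).trans h
      · exact (TambaraIdeal.mul_le_right I J).trans h)

end NakaokaSpectrum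

/-! ## The fixed-point Tambara functor -/

namespace FixedPointFunctor

variable (G : Type u) [Group G] (R : Type w) [CommRing R] [MulSemiringAction G R]

/-- The ring of equivariant functions `X → R`. -/
def equivariantFunctions (X : Type u) [MulAction G X] : Subring (X → R) where
  carrier := {a | ∀ (g : G) (x : X), a (g • x) = g • a x}
  mul_mem' ha hb g x := by simp [ha g x, hb g x]
  one_mem' g x := by simp
  add_mem' ha hb g x := by simp [ha g x, hb g x]
  zero_mem' g x := by simp
  neg_mem' ha g x := by simp [ha g x]

variable {G R}
variable {X Y : Type u} [MulAction G X] [MulAction G Y]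

/-- Translation by `g` identifies the fibre over `y` with the fibre over `g • y`. -/
def fibreEquiv (f : X →[G] Y) (g : G) (y : Y) : {x // f x = y} ≃ {x // f x = g • y} where
  toFun x := ⟨g • x.1, by rw [map_smul, x.2]⟩
  invFun x := ⟨g⁻¹ • x.1, by rw [map_smul, x.2, inv_smul_smul]⟩
  left_inv x := by simp
  right_inv x := by simp

/-- Restriction of equivariant functions: precomposition with `f`. -/
def res (f : X →[G] Y) : equivariantFunctions G R Y →+* equivariantFunctions G R X where
  toFun a := ⟨fun x => a.1 (f x), fun g x => by
    change a.1 (f (g • x)) = g • a.1 (f x)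
    rw [map_smul]
    exact a.2 g (f x)⟩
  map_one' := rfl
  map_mul' _ _ := rfl
  map_zero' := rfl
  map_add' _ _ := rfl

variable [Finite X]

/-- Transfer of equivariant functions: summation over the fibres of `f`. -/
noncomputable def tr (f : X →[G] Y) :
    equivariantFunctions G R X →+ equivariantFunctions G R Y where
  toFun a := ⟨fun y => ∑ᶠ x : {x // f x = y}, a.1 x, fun g y => by
    have h := (MulSemiringAction.toRingHom G R g).toAddMonoidHom.map_finsum
      (f := fun x : {x // f x = y} => a.1 x) (Set.toFinite _)
    refine Eq.trans ?_ h.symm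
    exact (finsum_eq_of_bijective _ (fibreEquiv f g y).bijective
      (fun x => (a.2 g x.1).symm)).symm⟩
  map_zero' := by
    ext y
    exact finsum_zero
  map_add' a b := by
    ext y
    exact finsum_add_distrib (Set.toFinite _) (Set.toFinite _)

/-- Norm of equivariant functions: multiplication over the fibres of `f`. -/
noncomputable def nm (f : X →[G] Y) :
    equivariantFunctions G R X →* equivariantFunctions G R Y where
  toFun a := ⟨fun y => ∏ᶠ x : {x // f x = y}, a.1 x, fun g y => by
    have h := (MulSemiringAction.toRingHom G R g).toMonoidHom.map_finprod
      (f := fun x : {x // f x = y} => a.1 x) (Set.toFinite _)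
    refine Eq.trans ?_ h.symm
    exact (finprod_eq_of_bijective _ (fibreEquiv f g y).bijective
      (fun x => (a.2 g x.1).symm)).symm⟩
  map_one' := by
    ext y
    exact finprod_one
  map_mul' a b := by
    ext y
    exact finprod_mul_distrib (Set.toFinite _) (Set.toFinite _)

@[to_additive]
theorem finprod_fibre_id {M X : Type*} [CommMonoid M] (a : X → M) (y : X) :
    ∏ᶠ x : {x // x = y}, a x = a y := by
  rw [finprod_unique]; rfl

@[to_additive]
theorem finprod_fibre_comp {M X Y Z : Type*} [CommMonoid M] [Finite X] [Finite Y] (h : Y → Z)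
    (f : X → Y) (a : X → M) (z : Z) :
    ∏ᶠ x : {x // h (f x) = z}, a x = ∏ᶠ y : {y // h y = z}, ∏ᶠ x : {x // f x = y.1}, a x := by
  classical
  have := Fintype.ofFinite X
  have := Fintype.ofFinite Y
  have := Fintype.ofFinite {y // h y = z}
  have : ∀ y : {y // h y = z}, Fintype {x // f x = y.1} := fun y => Fintype.ofFinite _
  rw [finprod_eq_prod_of_fintype (fun y : {y // h y = z} => ∏ᶠ x : {x // f x = y.1}, a x)]
  simp only [fun y : {y // h y = z} =>
    finprod_eq_prod_of_fintype (fun x : {x // f x = y.1} => a x)]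
  rw [← Fintype.prod_sigma'
    (fun (y : {y // h y = z}) (x : {x // f x = y.1}) => a x.1), ← finprod_eq_prod_of_fintype]
  refine finprod_eq_of_bijective
    (fun x : {x // h (f x) = z} =>
      (⟨⟨f x.1, x.2⟩, ⟨x.1, rfl⟩⟩ : (y : {y // h y = z}) × {x // f x = y.1})) ⟨?_, ?_⟩ fun x => rfl
  · rintro ⟨x, hx⟩ ⟨x', hx'⟩ hxx
    have := congrArg (fun s : (y : {y // h y = z}) × {x // f x = y.1} => s.2.1) hxx
    exact Subtype.ext this
  · rintro ⟨⟨y, hy⟩, ⟨x, hx⟩⟩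
    change f x = y at hx
    subst hx
    exact ⟨⟨x, hy⟩, rfl⟩

@[to_additive]
theorem finprod_fibre_pullback {M W X Y Z : Type*} [CommMonoid M] {a : W → X} {b : W → Z}
    {f : X → Y} {h : Z → Y} (H : IsPullbackSquare a b f h) (x : X → M) (z : Z) :
    ∏ᶠ t : {t // f t = h z}, x t = ∏ᶠ t : {t // b t = z}, x (a t) := by
  symm
  refine finprod_eq_of_bijective
    (fun t : {t // b t = z} => (⟨a t.1, by rw [H.1, t.2]⟩ : {t // f t = h z})) ⟨?_, ?_⟩ fun x => rfl
  · rintro ⟨t, ht⟩ ⟨t', ht'⟩ htt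
    have h1 : a t = a t' := congrArg Subtype.val htt
    obtain ⟨w, -, hw⟩ := H.2 (a t) z (by rw [H.1, ht])
    exact Subtype.ext ((hw t ⟨rfl, ht⟩).trans (hw t' ⟨h1.symm, ht'⟩).symm)
  · rintro ⟨t, ht⟩
    obtain ⟨w, hw, -⟩ := H.2 t z ht
    exact ⟨⟨w, hw.2⟩, Subtype.ext hw.1⟩

theorem finprod_finsum_fibre {S A X Y E P : Type*} [CommSemiring S] [Finite A] [Finite X]
    [Finite P] {p : A → X} {g : X → Y} {e : E → A} {π : E → X} {g' : E → P} {q : P → Y}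
    (H : IsExponentialDiagram p g e π g' q) (a : A → S) (y : Y) :
    ∏ᶠ x : {x // g x = y}, ∑ᶠ t : {t // p t = x.1}, a t =
      ∑ᶠ t : {t // q t = y}, ∏ᶠ z : {z // g' z = t.1}, a (e z) := by
  classical
  obtain ⟨H1, H2, H3⟩ := H
  have := Fintype.ofFinite {x // g x = y}
  have : ∀ x : {x // g x = y}, Fintype {t // p t = x.1} := fun x => Fintype.ofFinite _
  have hpt : ∀ t : {t // q t = y}, ∀ x : {x // g x = y}, ∃! z, π z = x.1 ∧ g' z = t.1 :=
    fun t x => H1.2 x.1 t.1 (by rw [x.2, t.2])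
  choose σ hσ hσ' using hpt
  simp only [finprod_eq_prod_of_fintype, finsum_eq_sum_of_fintype]
  rw [Fintype.prod_sum, ← finsum_eq_sum_of_fintype]
  symm
  refine finsum_eq_of_bijective
    (fun (t : {t // q t = y}) (x : {x // g x = y}) =>
      (⟨e (σ t x), by rw [H2, (hσ t x).1]⟩ : {t // p t = x.1})) ⟨?_, ?_⟩ ?_
  · intro t t' htt
    obtain ⟨r, -, hr⟩ := H3 y (fun x => e (σ t x)) (fun x => by rw [H2, (hσ t x).1])
    have key : ∀ s : {t // q t = y}, (∀ x, e (σ s x) = e (σ t x)) → s.1 = r := by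
      intro s hs
      refine hr s.1 ⟨s.2, fun z hz hzs => ?_⟩
      exact (congrArg e (hσ' s ⟨π z, hz⟩ z ⟨rfl, hzs⟩)).trans (hs ⟨π z, hz⟩)
    refine Subtype.ext ((key t fun _ => rfl).trans (key t' fun x => ?_).symm)
    exact (congrArg Subtype.val (congrFun htt x)).symm
  · intro s
    obtain ⟨r, ⟨hr1, hr2⟩, -⟩ := H3 y (fun x => (s x).1) (fun x => (s x).2)
    refine ⟨⟨r, hr1⟩, funext fun x => Subtype.ext ?_⟩
    have hx := hσ ⟨r, hr1⟩ x
    have h1 := hr2 (σ ⟨r, hr1⟩ x) (by rw [hx.1, x.2]) hx.2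
    have h2 : (⟨π (σ ⟨r, hr1⟩ x), by rw [hx.1, x.2]⟩ : {x // g x = y}) = x := Subtype.ext hx.1
    exact h1.trans (congrArg (fun x => (s x).1) h2)
  · intro t
    rw [← finprod_eq_prod_of_fintype]
    symm
    refine finprod_eq_of_bijective
      (fun x : {x // g x = y} => (⟨σ t x, (hσ t x).2⟩ : {z // g' z = t.1})) ⟨?_, ?_⟩ fun x => rfl
    · intro x x' hxx
      have h1 : σ t x = σ t x' := congrArg Subtype.val hxx
      exact Subtype.ext (by rw [← (hσ t x).1, h1, (hσ t x').1])
    · rintro ⟨z, hz⟩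
      have hy : g (π z) = y := by rw [H1.1, hz, t.2]
      exact ⟨⟨π z, hy⟩, Subtype.ext (hσ' t ⟨π z, hy⟩ z ⟨rfl, hz⟩).symm⟩

end FixedPointFunctor

open FixedPointFunctor in
/-- The fixed-point Tambara functor `FP(R)` of a commutative ring `R` with `G`-action. Its value
at `X` is the ring of equivariant functions `X → R`, so that `FP(R)(G/H) = R^H`; restriction
is precomposition, transfer is the sum over the fibres, norm is the product over the fibres. -/
noncomputable def FP (G : Type u) [Group G] (R : Type w) [CommRing R] [MulSemiringAction G R] :
    TambaraFunctor.{u, max u w} G where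
  obj X _ _ := equivariantFunctions G R X
  res f := res f
  tr f := tr f
  nm f := nm f
  res_id _ := rfl
  tr_id a := by
    ext y
    exact finsum_fibre_id a.1 y
  nm_id a := by
    ext y
    exact finprod_fibre_id a.1 y
  res_comp _ _ _ := rfl
  tr_comp h f a := by
    ext z
    exact finsum_fibre_comp h f a.1 z
  nm_comp h f a := by
    ext z
    exact finprod_fibre_comp h f a.1 z
  obj_empty X _ _ _ := ⟨fun a b => Subtype.ext (funext fun x => isEmptyElim x)⟩
  obj_sum {X Y Z} _ _ _ _ _ _ i j hij := by
    constructor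
    · intro a b hab
      ext z
      obtain ⟨t, rfl⟩ := hij.2 z
      have h1 := congrArg Prod.fst hab
      have h2 := congrArg Prod.snd hab
      rcases t with x | y
      · exact congrFun (congrArg Subtype.val h1) x
      · exact congrFun (congrArg Subtype.val h2) y
    · rintro ⟨a, b⟩
      let k := Equiv.ofBijective _ hij
      have hi : ∀ x, k.symm (i x) = Sum.inl x := fun x => k.symm_apply_apply (Sum.inl x)
      have hj : ∀ y, k.symm (j y) = Sum.inr y := fun y => k.symm_apply_apply (Sum.inr y)
      refine ⟨⟨fun z => Sum.elim a.1 b.1 (k.symm z), fun g z => ?_⟩, Prod.ext ?_ ?_⟩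
      · obtain ⟨t, rfl⟩ := k.surjective z
        rcases t with x | y
        · change Sum.elim a.1 b.1 (k.symm (g • i x)) = g • Sum.elim a.1 b.1 (k.symm (i x))
          rw [← map_smul, hi, hi]
          exact a.2 g x
        · change Sum.elim a.1 b.1 (k.symm (g • j y)) = g • Sum.elim a.1 b.1 (k.symm (j y))
          rw [← map_smul, hj, hj]
          exact b.2 g y
      · ext x
        change Sum.elim a.1 b.1 (k.symm (i x)) = a.1 x
        rw [hi]; rfl
      · ext y
        change Sum.elim a.1 b.1 (k.symm (j y)) = b.1 y
        rw [hj]; rfl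
  res_tr a b f h H x := by
    ext z
    exact finsum_fibre_pullback H x.1 z
  res_nm a b f h H x := by
    ext z
    exact finprod_fibre_pullback H x.1 z
  nm_tr p g e π g' q H a := by
    ext y
    exact finprod_finsum_fibre H a.1 y

namespace FP

variable (G : Type u) [Group G] [Finite G] (R : Type w) [CommRing R] [MulSemiringAction G R]

/-- The identification `FP(R)(G/H) = R^H`: evaluation at the identity coset. -/
noncomputable def levelEquiv (H : Subgroup G) : (FP G R).level H ≃+* FixedPoints.subring R H where
  toFun a := ⟨a.1 (1 : G), fun h => by
    change (h : G) • a.1 ((1 : G) : G ⧸ H) = _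
    rw [← a.2]
    refine congrArg a.1 ?_
    change ((h * 1 : G) : G ⧸ H) = _
    rw [QuotientGroup.eq]
    simp⟩
  invFun r := ⟨fun x => Quotient.liftOn' x (fun g => g • (r : R)) (by
      intro g g' hg
      rw [QuotientGroup.leftRel_apply] at hg
      have h1 : (g⁻¹ * g') • (r : R) = r := r.2 ⟨_, hg⟩
      change g • (r : R) = g' • (r : R)
      rw [← h1, smul_smul, mul_inv_cancel_left, h1]), fun g x => by
    induction x using QuotientGroup.induction_on with
    | H x => exact mul_smul g x (r : R)⟩
  left_inv a := by
    refine Subtype.ext (funext fun x => ?_)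
    induction x using QuotientGroup.induction_on with
    | H x =>
      change x • a.1 ((1 : G) : G ⧸ H) = a.1 (x : G ⧸ H)
      rw [← a.2]
      refine congrArg a.1 ?_
      change ((x * 1 : G) : G ⧸ H) = _
      rw [mul_one]
  right_inv r := Subtype.ext (one_smul G (r : R))
  map_mul' _ _ := rfl
  map_add' _ _ := rfl

/-- The identification `FP(R)(G/G) = R^G`. -/
noncomputable def topEquiv : (FP G R).level ⊤ ≃+* FixedPoints.subring R G :=
  (levelEquiv G R ⊤).trans (RingEquiv.subringCongr (by
    ext x
    exact ⟨fun h g => h ⟨g, Subgroup.mem_top g⟩, fun h g => h g⟩))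

/-- The identification `FP(R)(G/e) = R`. -/
noncomputable def botEquiv : (FP G R).level ⊥ ≃+* R :=
  (levelEquiv G R ⊥).trans ((RingEquiv.subringCongr (by
    rw [eq_top_iff]
    intro x _ g
    have : (g : G) = 1 := g.2
    change (g : G) • x = x
    rw [this, one_smul])).trans Subring.topEquiv)

end FP

/-! ## The other spectra -/

/-- The induced ring homomorphism `R^G → S^G`. -/
def fixedRingHom {G : Type u} [Group G] {R S : Type w} [CommRing R] [MulSemiringAction G R]
    [CommRing S] [MulSemiringAction G S] (f : R →+*[G] S) :
    FixedPoints.subring R G →+* FixedPoints.subring S G :=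
  RingHom.restrict (f : R →+* S) _ _ fun x hx g => by
    change g • f x = f x
    rw [← map_smul, hx g]

/-- The ring homomorphism `FP(R)(X) → FP(S)(X)` induced by an equivariant ring homomorphism
`R → S`: postcomposition. -/
noncomputable def FP.map {G : Type u} [Group G] {R S : Type w} [CommRing R] [MulSemiringAction G R]
    [CommRing S] [MulSemiringAction G S] (f : R →+*[G] S)
    (X : Type u) [MulAction G X] [Finite X] : (FP G R).obj X →+* (FP G S).obj X where
  toFun a := ⟨fun x => f (a.1 x), fun g x =>
    (congrArg f (a.2 g x)).trans (map_smul f g (a.1 x))⟩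
  map_one' := Subtype.ext (funext fun _ => map_one f)
  map_mul' _ _ := Subtype.ext (funext fun _ => map_mul f _ _)
  map_zero' := Subtype.ext (funext fun _ => map_zero f)
  map_add' _ _ := Subtype.ext (funext fun _ => map_add f _ _)

section Spectra

variable (G : Type u) [Group G] (R : Type w) [CommRing R] [MulSemiringAction G R]

/-- The set `Spec_G(R)` of `G`-prime ideals of `R`. -/
@[ext]
structure GPrimeSpectrum where
  ideal : Ideal R
  invariant : ∀ (g : G), ∀ x ∈ ideal, g • x ∈ ideal
  ne_top : ideal ≠ ⊤
  mem_or_mem : ∀ x y : R, (∀ g : G, x * (g • y) ∈ ideal) → x ∈ ideal ∨ y ∈ ideal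

/-- Inclusion of `G`-prime ideals. -/
instance : PartialOrder (GPrimeSpectrum G R) :=
  PartialOrder.lift GPrimeSpectrum.ideal fun _ _ => GPrimeSpectrum.ext

variable {R} in
/-- The action of `G` on `Spec(R)`: `x ∈ g • p` if and only if `g⁻¹ • x ∈ p`. -/
instance : MulAction G (PrimeSpectrum R) where
  smul g p := PrimeSpectrum.comap (MulSemiringAction.toRingHom G R g⁻¹) p
  one_smul p := by
    ext x
    change (1 : G)⁻¹ • x ∈ p.asIdeal ↔ _
    simp
  mul_smul g h p := by
    ext x
    change (g * h)⁻¹ • x ∈ p.asIdeal ↔ h⁻¹ • g⁻¹ • x ∈ p.asIdeal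
    rw [mul_inv_rev, mul_smul]

/-- The set of orbits `Spec(R)/G`. -/
def SpecModG : Type w := MulAction.orbitRel.Quotient G (PrimeSpectrum R)

/-- The quotient topology of the Zariski topology. -/
instance : TopologicalSpace (SpecModG G R) :=
  inferInstanceAs (TopologicalSpace (Quotient (MulAction.orbitRel G (PrimeSpectrum R))))

variable {R} in
/-- The orbit of a prime ideal. -/
def SpecModG.mk (p : PrimeSpectrum R) : SpecModG G R :=
  Quotient.mk (MulAction.orbitRel G (PrimeSpectrum R)) p

variable {G R} in
theorem smul_le_smul_primeSpectrum (g : G) {p q : PrimeSpectrum R} (h : p ≤ q) : g • p ≤ g • q :=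
  fun _ hx => h hx

/-- The order on `Spec(R)/G` induced by inclusion: `a ≤ b` if some prime in the orbit `a` is
contained in some prime in the orbit `b`. -/
instance : LE (SpecModG G R) where
  le a b := ∃ p q : PrimeSpectrum R, SpecModG.mk G p = a ∧ SpecModG.mk G q = b ∧ p ≤ q

instance [Finite G] : PartialOrder (SpecModG G R) where
  le_refl a := by
    obtain ⟨p, rfl⟩ := Quotient.exists_rep a
    exact ⟨p, p, rfl, rfl, le_rfl⟩
  le_trans := by
    rintro _ _ _ ⟨p, q, rfl, rfl, h⟩ ⟨q', r, hq, rfl, h'⟩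
    obtain ⟨g, hg⟩ := Quotient.exact hq.symm
    refine ⟨g⁻¹ • p, r, Quotient.sound ⟨g⁻¹, rfl⟩, rfl, le_trans ?_ h'⟩
    have hg : g • q' = q := hg
    have h1 : g⁻¹ • p ≤ g⁻¹ • q := smul_le_smul_primeSpectrum g⁻¹ h
    rwa [← hg, inv_smul_smul] at h1
  le_antisymm := by
    rintro _ _ ⟨p, q, rfl, rfl, h⟩ ⟨q', p', hq, hp, h'⟩
    obtain ⟨g, hg⟩ := Quotient.exact hq
    obtain ⟨k, hk⟩ := Quotient.exact hp
    have hg : g • q = q' := hg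
    have hk : k • p = p' := hk
    subst hg hk
    have h1 : q ≤ (g⁻¹ * k) • p := by
      have := smul_le_smul_primeSpectrum g⁻¹ h'
      rwa [inv_smul_smul, smul_smul] at this
    have hn : ∀ n : ℕ, (g⁻¹ * k) • p ≤ (g⁻¹ * k) ^ (n + 1) • p := by
      intro n
      induction n with
      | zero => simp
      | succ n ih =>
        refine ih.trans ?_
        rw [pow_succ (g⁻¹ * k) (n + 1), mul_smul]
        exact smul_le_smul_primeSpectrum _ (h.trans h1)
    have h2 := hn (orderOf (g⁻¹ * k) - 1)
    rw [Nat.sub_add_cancel (orderOf_pos _), pow_orderOf_eq_one, one_smul] at h2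
    have h3 : q = p := le_antisymm (h1.trans h2) h
    rw [h3]

end Spectra

/-! ## Values of the fixed-point functor -/

namespace FP

variable {G : Type u} [Group G] {R : Type w} [CommRing R] [MulSemiringAction G R]

/-- The underlying function `X → R` of an element of `FP(R)(X)`. -/
noncomputable def toFun (X : Type u) [MulAction G X] [Finite X] : (FP G R).obj X →+* (X → R) :=
  (FixedPointFunctor.equivariantFunctions G R X).subtype

section

variable {X Y : Type u} [MulAction G X] [Finite X] [MulAction G Y] [Finite Y]

theorem ext {a b : (FP G R).obj X} (h : ∀ x, toFun X a x = toFun X b x) : a = b :=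
  Subtype.ext (funext h)

theorem toFun_smul (a : (FP G R).obj X) (g : G) (x : X) :
    toFun X a (g • x) = g • toFun X a x := a.2 g x

theorem exists_toFun_eq (a : X → R) (ha : ∀ (g : G) (x : X), a (g • x) = g • a x) :
    ∃ b : (FP G R).obj X, toFun X b = a := ⟨⟨a, ha⟩, rfl⟩

theorem toFun_res (f : X →[G] Y) (a : (FP G R).obj Y) (x : X) :
    toFun X ((FP G R).res f a) x = toFun Y a (f x) := rfl

theorem toFun_tr (f : X →[G] Y) (a : (FP G R).obj X) (y : Y) :
    toFun Y ((FP G R).tr f a) y = ∑ᶠ x : {x // f x = y}, toFun X a x := rfl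

theorem toFun_nm (f : X →[G] Y) (a : (FP G R).obj X) (y : Y) :
    toFun Y ((FP G R).nm f a) y = ∏ᶠ x : {x // f x = y}, toFun X a x := rfl

end

end FP

/-! ## Extension of a Tambara ideal to finite `G`-sets -/

/-- The fibre product of two equivariant maps as an invariant subset of the product. -/
def equivariantPullback {G : Type u} [Group G] {X Y Z : Type u} [MulAction G X] [MulAction G Y]
    [MulAction G Z] (f : X →[G] Y) (h : Z →[G] Y) : SubMulAction G (X × Z) where
  carrier := {p | f p.1 = h p.2}
  smul_mem' g p hp := by
    change f (g • p.1) = h (g • p.2)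
    rw [map_smul, map_smul]
    exact congrArg _ hp

section Pullback

variable {G : Type u} [Group G] {X Y Z : Type u} [MulAction G X] [MulAction G Y] [MulAction G Z]

/-- The first projection of a fibre product. -/
def equivariantPullback.fst (f : X →[G] Y) (h : Z →[G] Y) : equivariantPullback f h →[G] X where
  toFun p := p.1.1
  map_smul' _ _ := rfl

/-- The second projection of a fibre product. -/
def equivariantPullback.snd (f : X →[G] Y) (h : Z →[G] Y) : equivariantPullback f h →[G] Z where
  toFun p := p.1.2
  map_smul' _ _ := rfl

theorem isPullbackSquare_equivariantPullback (f : X →[G] Y) (h : Z →[G] Y) :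
    IsPullbackSquare (equivariantPullback.fst f h) (equivariantPullback.snd f h) f h :=
  ⟨fun w => w.2, fun x z hxz => ⟨⟨(x, z), hxz⟩, ⟨rfl, rfl⟩,
    fun _ hw => Subtype.ext (Prod.ext hw.1 hw.2)⟩⟩

end Pullback

/-- Every equivariant map between orbits is a projection followed by a conjugation. -/
theorem exists_orbitConj_comp_orbitProj {G : Type u} [Group G] {L K : Subgroup G}
    (f : (G ⧸ L) →[G] (G ⧸ K)) :
    ∃ (g : G) (h : L ≤ conjSubgroup g K), f = (orbitConj g K).comp (orbitProj h) := by
  obtain ⟨g, hg⟩ := QuotientGroup.mk_surjective (f ((1 : G) : G ⧸ L))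
  have hf : ∀ x : G, f (x : G ⧸ L) = ((x * g : G) : G ⧸ K) := by
    intro x
    have h1 : ((x : G) : G ⧸ L) = x • ((1 : G) : G ⧸ L) := by
      change _ = ((x * 1 : G) : G ⧸ L)
      rw [mul_one]
    rw [h1, map_smul, ← hg]
    rfl
  refine ⟨g, fun l hl => ?_, ?_⟩
  · have h1 : ((l : G) : G ⧸ L) = ((1 : G) : G ⧸ L) := by
      rw [QuotientGroup.eq]; simpa using hl
    have h2 := congrArg f h1
    rw [hf, hf, eq_comm, QuotientGroup.eq] at h2
    refine ⟨_, h2, ?_⟩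
    simp [mul_assoc]
  · ext x
    obtain ⟨x, rfl⟩ := QuotientGroup.mk_surjective x
    rw [hf]
    rfl

namespace TambaraIdeal

variable {G : Type u} [Group G] [Finite G]

/-- The value of a Tambara ideal at a finite `G`-set: the elements all of whose restrictions to
orbits lie in the ideal. -/
def extend {T : TambaraFunctor.{u, v} G} (P : TambaraIdeal T) (X : Type u) [MulAction G X]
    [Finite X] : Ideal (T.obj X) :=
  ⨅ (K : Subgroup G) (f : (G ⧸ K) →[G] X), (P.level K).comap (T.res f)

theorem mem_extend {T : TambaraFunctor.{u, v} G} {P : TambaraIdeal T} {X : Type u} [MulAction G X]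
    [Finite X] {a : T.obj X} :
    a ∈ P.extend X ↔ ∀ (K : Subgroup G) (f : (G ⧸ K) →[G] X), T.res f a ∈ P.level K := by
  simp [extend, Submodule.mem_iInf, Ideal.mem_comap]

theorem extend_quotient {T : TambaraFunctor.{u, v} G} (P : TambaraIdeal T) (K : Subgroup G) :
    P.extend (G ⧸ K) = P.level K := by
  ext a
  rw [mem_extend]
  constructor
  · intro h
    simpa only [T.res_id] using h K (MulActionHom.id G)
  · intro h L f
    obtain ⟨g, hg, rfl⟩ := exists_orbitConj_comp_orbitProj f
    rw [T.res_comp]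
    exact P.res_mem hg _ (P.conj_mem g K a h)

theorem res_mem_extend {T : TambaraFunctor.{u, v} G} {P : TambaraIdeal T} {X Y : Type u}
    [MulAction G X] [Finite X] [MulAction G Y] [Finite Y] (f : X →[G] Y) {a : T.obj Y}
    (ha : a ∈ P.extend Y) : T.res f a ∈ P.extend X := by
  rw [mem_extend] at ha ⊢
  intro K h
  rw [← T.res_comp]
  exact ha K (f.comp h)

end TambaraIdeal

/-! ### Decomposition of fibres into orbits -/

@[to_additive]
theorem finprod_eq_prod_finprod_of_bijective {M α ι : Type*} {β : ι → Type*} [CommMonoid M]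
    [Fintype ι] [∀ i, Finite (β i)] {e : (Σ i, β i) → α} (he : Function.Bijective e) (a : α → M) :
    ∏ᶠ x, a x = ∏ i, ∏ᶠ t : β i, a (e ⟨i, t⟩) := by
  have := fun i => Fintype.ofFinite (β i)
  simp only [finprod_eq_prod_of_fintype (M := M)]
  rw [← Fintype.prod_sigma' (fun i (t : β i) => a (e ⟨i, t⟩)), ← finprod_eq_prod_of_fintype]
  exact (finprod_eq_of_bijective e he fun _ => rfl).symm

section OrbitDecomposition

variable {G : Type u} [Group G] {X : Type u} [MulAction G X]

/-- The equivariant map `G/L → X` determined by a point with stabilizer `L`. -/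
def orbitMap (x : X) : (G ⧸ MulAction.stabilizer G x) →[G] X where
  toFun := MulAction.ofQuotientStabilizer G x
  map_smul' g t := MulAction.ofQuotientStabilizer_smul G x g t

variable {K : Subgroup G} (f : X →[G] (G ⧸ K))

theorem exists_orbit_representatives :
    ∃ r : MulAction.orbitRel.Quotient G X → X,
      (∀ ω, Quotient.mk _ (r ω) = ω) ∧ ∀ ω, f (r ω) = ((1 : G) : G ⧸ K) := by
  have : ∀ ω : MulAction.orbitRel.Quotient G X,
      ∃ x : X, Quotient.mk _ x = ω ∧ f x = ((1 : G) : G ⧸ K) := by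
    intro ω
    obtain ⟨x, rfl⟩ := Quotient.exists_rep ω
    obtain ⟨g, hg⟩ := QuotientGroup.mk_surjective (f x)
    refine ⟨g⁻¹ • x, Quotient.sound ⟨g⁻¹, rfl⟩, ?_⟩
    rw [map_smul, ← hg]
    change ((g⁻¹ * g : G) : G ⧸ K) = _
    rw [inv_mul_cancel]
  choose r h1 h2 using this
  exact ⟨r, h1, h2⟩

theorem stabilizer_le_of_map_eq_one {x : X} (hx : f x = ((1 : G) : G ⧸ K)) :
    MulAction.stabilizer G x ≤ K := by
  intro g hg
  have h1 : f (g • x) = f x := congrArg f hg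
  rw [map_smul, hx] at h1
  have h2 : ((1 : G) : G ⧸ K) = ((g * 1 : G) : G ⧸ K) := h1.symm
  rw [QuotientGroup.eq] at h2
  simpa using h2

theorem map_orbitMap {x : X} (hx : f x = ((1 : G) : G ⧸ K))
    (t : G ⧸ MulAction.stabilizer G x) :
    f (orbitMap x t) = orbitProj (stabilizer_le_of_map_eq_one f hx) t := by
  obtain ⟨g, rfl⟩ := QuotientGroup.mk_surjective t
  change f (g • x) = ((g : G) : G ⧸ K)
  rw [map_smul, hx]
  change ((g * 1 : G) : G ⧸ K) = _
  rw [mul_one]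

/-- The fibre of an equivariant map `X → G/K` is the disjoint union of its intersections with the
orbits of `X`. -/
theorem bijective_orbitMap_fibre {r : MulAction.orbitRel.Quotient G X → X}
    (hr : ∀ ω, Quotient.mk _ (r ω) = ω) (hr1 : ∀ ω, f (r ω) = ((1 : G) : G ⧸ K)) (y : G ⧸ K) :
    Function.Bijective (fun s : (ω : MulAction.orbitRel.Quotient G X) ×
      {t // orbitProj (stabilizer_le_of_map_eq_one f (hr1 ω)) t = y} =>
        (⟨orbitMap (r s.1) s.2.1, (map_orbitMap f (hr1 s.1) s.2.1).trans s.2.2⟩ :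
          {x // f x = y})) := by
  constructor
  · have hmk : ∀ ω (t : G ⧸ MulAction.stabilizer G (r ω)),
        (Quotient.mk _ (orbitMap (r ω) t) : MulAction.orbitRel.Quotient G X) = ω := by
      intro ω t
      obtain ⟨g, rfl⟩ := QuotientGroup.mk_surjective t
      exact (Quotient.sound (s := MulAction.orbitRel G X) ⟨g, rfl⟩).trans (hr ω)
    rintro ⟨ω, t, ht⟩ ⟨ω', t', ht'⟩ h
    have h1 : orbitMap (r ω) t = orbitMap (r ω') t' := congrArg Subtype.val h
    obtain rfl : ω = ω' := by rw [← hmk ω t, h1, hmk]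
    obtain rfl : t = t' := MulAction.injective_ofQuotientStabilizer G (r ω) h1
    rfl
  · rintro ⟨x, hx⟩
    obtain ⟨g, hg⟩ : ∃ g : G, g • r (Quotient.mk _ x) = x := Quotient.exact (hr _).symm
    let t : G ⧸ MulAction.stabilizer G (r (Quotient.mk _ x)) := QuotientGroup.mk g
    have h1 : orbitProj (stabilizer_le_of_map_eq_one f (hr1 (Quotient.mk _ x))) t = y := by
      rw [← map_orbitMap f (hr1 _)]
      exact (congrArg f hg).trans hx
    exact ⟨⟨Quotient.mk _ x, t, h1⟩, Subtype.ext hg⟩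

end OrbitDecomposition

namespace TambaraIdeal

variable {G : Type u} [Group G] [Finite G] {R : Type w} [CommRing R] [MulSemiringAction G R]
  {P : TambaraIdeal (FP G R)} {X Y : Type u} [MulAction G X] [Finite X] [MulAction G Y] [Finite Y]

theorem tr_mem_level_of_mem_extend {K : Subgroup G} (f : X →[G] (G ⧸ K)) {a : (FP G R).obj X}
    (ha : a ∈ P.extend X) : (FP G R).tr f a ∈ P.level K := by
  classical
  obtain ⟨r, hr, hr1⟩ := exists_orbit_representatives f
  have := Fintype.ofFinite (MulAction.orbitRel.Quotient G X)
  have h : (FP G R).tr f a = ∑ ω, (FP G R).levelTr (stabilizer_le_of_map_eq_one f (hr1 ω))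
      ((FP G R).res (orbitMap (r ω)) a) := by
    refine FP.ext fun y => ?_
    rw [map_sum, Finset.sum_apply]
    exact finsum_eq_sum_finsum_of_bijective (bijective_orbitMap_fibre f hr hr1 y)
      fun x => FP.toFun X a x.1
  rw [h]
  exact sum_mem fun ω _ => P.tr_mem _ _ (mem_extend.1 ha _ _)

theorem nm_mem_level_of_mem_extend {K : Subgroup G} (f : X →[G] (G ⧸ K)) [Nonempty X]
    {a : (FP G R).obj X} (ha : a ∈ P.extend X) : (FP G R).nm f a ∈ P.level K := by
  classical
  obtain ⟨r, hr, hr1⟩ := exists_orbit_representatives f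
  have := Fintype.ofFinite (MulAction.orbitRel.Quotient G X)
  have h : (FP G R).nm f a = ∏ ω, (FP G R).levelNm (stabilizer_le_of_map_eq_one f (hr1 ω))
      ((FP G R).res (orbitMap (r ω)) a) := by
    refine FP.ext fun y => ?_
    rw [map_prod, Finset.prod_apply]
    exact finprod_eq_prod_finprod_of_bijective (bijective_orbitMap_fibre f hr hr1 y)
      fun x => FP.toFun X a x.1
  rw [h]
  let x : X := Classical.arbitrary X
  exact Ideal.mem_of_dvd _ (Finset.dvd_prod_of_mem _ (Finset.mem_univ (Quotient.mk _ x)))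
    (P.nm_mem _ _ (mem_extend.1 ha _ _))

theorem tr_mem_extend (f : X →[G] Y) {a : (FP G R).obj X} (ha : a ∈ P.extend X) :
    (FP G R).tr f a ∈ P.extend Y := by
  rw [mem_extend]
  intro K h
  rw [(FP G R).res_tr _ _ _ _ (isPullbackSquare_equivariantPullback f h)]
  exact tr_mem_level_of_mem_extend _ (res_mem_extend _ ha)

theorem nm_mem_extend (f : X →[G] Y) (hf : Function.Surjective f) {a : (FP G R).obj X}
    (ha : a ∈ P.extend X) : (FP G R).nm f a ∈ P.extend Y := by
  rw [mem_extend]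
  intro K h
  rw [(FP G R).res_nm _ _ _ _ (isPullbackSquare_equivariantPullback f h)]
  obtain ⟨x, hx⟩ := hf (h ((1 : G) : G ⧸ K))
  have : Nonempty (equivariantPullback f h) := ⟨⟨(x, ((1 : G) : G ⧸ K)), hx⟩⟩
  exact nm_mem_level_of_mem_extend _ (res_mem_extend _ ha)

end TambaraIdeal

/-! ## Existence of exponential diagrams -/

section Exponential

open scoped Pointwise

variable {G : Type u} [Group G] {A X Y : Type u} [MulAction G A] [MulAction G X] [MulAction G Y]

/-- The dependent product of `p : A → X` along `g : X → Y`: a point over `y` is the image of a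
section of `p` over the fibre of `g` over `y`. -/
def dependentProduct (p : A →[G] X) (g : X →[G] Y) : SubMulAction G (Y × Set A) where
  carrier := {t | (∀ b ∈ t.2, g (p b) = t.1) ∧ ∀ x, g x = t.1 → ∃! b, b ∈ t.2 ∧ p b = x}
  smul_mem' k := by
    rintro ⟨y, S⟩ ⟨h1, h2⟩
    refine ⟨?_, fun x hx => ?_⟩
    · rintro _ ⟨b, hb, rfl⟩
      change g (p (k • b)) = k • y
      rw [map_smul, map_smul, h1 b hb]
    · change g x = k • y at hx
      obtain ⟨b, ⟨hb, hbx⟩, hu⟩ := h2 (k⁻¹ • x) (by rw [map_smul, hx, inv_smul_smul])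
      refine ⟨k • b, ⟨⟨b, hb, rfl⟩, by rw [map_smul, hbx, smul_inv_smul]⟩, ?_⟩
      rintro _ ⟨⟨b', hb', rfl⟩, hx'⟩
      change p (k • b') = x at hx'
      change k • b' = k • b
      rw [hu b' ⟨hb', by rw [← hx', map_smul, inv_smul_smul]⟩]

/-- The points of the sections parametrized by the dependent product. -/
def dependentProductIncidence (p : A →[G] X) (g : X →[G] Y) :
    SubMulAction G (dependentProduct p g × A) where
  carrier := {z | z.2 ∈ z.1.1.2}
  smul_mem' _ z hz := ⟨z.2, hz, rfl⟩

namespace dependentProduct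

variable (p : A →[G] X) (g : X →[G] Y)

/-- The structure map of the dependent product. -/
def proj : dependentProduct p g →[G] Y where
  toFun t := t.1.1
  map_smul' _ _ := rfl

/-- Evaluation of sections. -/
def eval : dependentProductIncidence p g →[G] A where
  toFun z := z.1.2
  map_smul' _ _ := rfl

/-- The section a point of the incidence set belongs to. -/
def incidenceProj : dependentProductIncidence p g →[G] dependentProduct p g where
  toFun z := z.1.1
  map_smul' _ _ := rfl

theorem isExponentialDiagram : IsExponentialDiagram p g (eval p g) (p.comp (eval p g))
    (incidenceProj p g) (proj p g) := by
  refine ⟨⟨fun z => z.1.1.2.1 _ z.2, fun x t hxt => ?_⟩, fun _ => rfl, fun y s hs => ?_⟩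
  · obtain ⟨b, ⟨hb, hbx⟩, hu⟩ := t.2.2 x hxt
    refine ⟨⟨(t, b), hb⟩, ⟨hbx, rfl⟩, ?_⟩
    rintro ⟨⟨t', b'⟩, hb'⟩ ⟨h1, rfl⟩
    obtain rfl : b' = b := hu b' ⟨hb', h1⟩
    rfl
  · refine ⟨⟨(y, Set.range s), ?_, fun x hx => ?_⟩, ⟨rfl, ?_⟩, ?_⟩
    · rintro _ ⟨x, rfl⟩
      rw [hs]
      exact x.2
    · refine ⟨s ⟨x, hx⟩, ⟨⟨_, rfl⟩, hs _⟩, ?_⟩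
      rintro _ ⟨⟨x', rfl⟩, hx'⟩
      exact congrArg s (Subtype.ext ((hs x').symm.trans hx'))
    · rintro ⟨⟨t, b⟩, hb⟩ hz rfl
      obtain ⟨x, hx⟩ := hb
      change b = s ⟨p b, hz⟩
      change s x = b at hx
      subst hx
      exact congrArg s (Subtype.ext (hs x).symm)
    · rintro t ⟨rfl, ht⟩
      have key : ∀ b (hb : b ∈ t.1.2), b = s ⟨p b, t.2.1 b hb⟩ := fun b hb =>
        ht ⟨(t, b), hb⟩ (t.2.1 b hb) rfl
      refine Subtype.ext (Prod.ext rfl (Set.ext fun b => ⟨fun hb => ⟨_, (key b hb).symm⟩, ?_⟩))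
      rintro ⟨⟨x, hx⟩, rfl⟩
      obtain ⟨b, ⟨hb, rfl⟩, -⟩ := t.2.2 x hx
      have := key b hb
      exact this ▸ hb

theorem incidenceProj_surjective (hg : Function.Surjective g) :
    Function.Surjective (incidenceProj p g) := by
  intro t
  obtain ⟨x, hx⟩ := hg t.1.1
  obtain ⟨b, ⟨hb, -⟩, -⟩ := t.2.2 x hx
  exact ⟨⟨(t, b), hb⟩, rfl⟩

end dependentProduct

end Exponential

/-! ## The powers of the ideal generated by an element -/

namespace FP

variable {G : Type u} [Group G] {R : Type w} [CommRing R] [MulSemiringAction G R]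

theorem mul_tr {X Y : Type u} [MulAction G X] [Finite X] [MulAction G Y] [Finite Y] (f : X →[G] Y)
    (a : (FP G R).obj X) (b : (FP G R).obj Y) :
    b * (FP G R).tr f a = (FP G R).tr f ((FP G R).res f b * a) := by
  refine FP.ext fun y => ?_
  rw [map_mul, Pi.mul_apply, toFun_tr, toFun_tr, mul_finsum' _ _ (Set.toFinite _)]
  refine finsum_congr fun x => ?_
  rw [map_mul, Pi.mul_apply, toFun_res, x.2]

/-- The action on a disjoint union, and the induced map out of it. -/
def sumElim {A B X : Type u} [MulAction G A] [MulAction G B] [MulAction G X] (f : A →[G] X)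
    (h : B →[G] X) : (A ⊕ B) →[G] X where
  toFun := Sum.elim f h
  map_smul' g z := by
    rcases z with a | b
    · exact map_smul f g a
    · exact map_smul h g b

theorem tr_sumElim {A B X : Type u} [MulAction G A] [MulAction G B] [MulAction G X] [Finite A]
    [Finite B] [Finite X] (f : A →[G] X) (h : B →[G] X) (a : (FP G R).obj (A ⊕ B))
    (a₁ : (FP G R).obj A) (a₂ : (FP G R).obj B) (h₁ : ∀ x, toFun _ a (Sum.inl x) = toFun _ a₁ x)
    (h₂ : ∀ x, toFun _ a (Sum.inr x) = toFun _ a₂ x) :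
    (FP G R).tr (sumElim f h) a = (FP G R).tr f a₁ + (FP G R).tr h a₂ := by
  classical
  refine FP.ext fun x => ?_
  have := Fintype.ofFinite {s // f s = x}
  have := Fintype.ofFinite {s // h s = x}
  rw [map_add, Pi.add_apply, toFun_tr, toFun_tr, toFun_tr,
    finsum_eq_sum_of_fintype (fun s : {s // f s = x} => _),
    finsum_eq_sum_of_fintype (fun s : {s // h s = x} => _),
    ← Fintype.sum_sumElim, ← finsum_eq_sum_of_fintype]
  symm
  refine finsum_eq_of_bijective (Sum.elim (fun s => ⟨Sum.inl s.1, s.2⟩)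
    (fun s => ⟨Sum.inr s.1, s.2⟩)) ⟨?_, ?_⟩ ?_
  · rintro (⟨s, hs⟩ | ⟨s, hs⟩) (⟨s', hs'⟩ | ⟨s', hs'⟩) hss <;>
      simpa using congrArg Subtype.val hss
  · rintro ⟨s | s, hs⟩
    · exact ⟨Sum.inl ⟨s, hs⟩, rfl⟩
    · exact ⟨Sum.inr ⟨s, hs⟩, rfl⟩
  · rintro (⟨s, hs⟩ | ⟨s, hs⟩)
    · exact (h₁ s).symm
    · exact (h₂ s).symm

section Monomial

variable {T : Type u} [MulAction G T] [Fintype T] (a : (FP G R).obj T)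

/-- An element of `FP(R)(B)` is a monomial of degree at least `n` in the values of `a` if it is an
equivariant family of multiples of monomials of degree at least `n`. -/
def IsMonomial (n : ℕ) {B : Type u} [MulAction G B] [Finite B] (F : (FP G R).obj B) : Prop :=
  ∃ (c : (FP G R).obj B) (m : B → T → ℕ), (∀ (g : G) b t, m (g • b) (g • t) = m b t) ∧
    (∀ b, n ≤ ∑ t, m b t) ∧ ∀ b, toFun B F b = toFun B c b * ∏ t, toFun T a t ^ m b t

variable {a} {n k : ℕ} {B X Y : Type u} [MulAction G B] [Finite B] [MulAction G X] [Finite X]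
  [MulAction G Y] [Finite Y]

theorem IsMonomial.mul_left {F : (FP G R).obj B} (hF : IsMonomial a n F) (r : (FP G R).obj B) :
    IsMonomial a n (r * F) := by
  obtain ⟨c, m, hm, hn, h⟩ := hF
  refine ⟨r * c, m, hm, hn, fun b => ?_⟩
  rw [map_mul, Pi.mul_apply, h, map_mul, Pi.mul_apply, mul_assoc]

theorem IsMonomial.mul {F F' : (FP G R).obj B} (hF : IsMonomial a n F) (hF' : IsMonomial a k F') :
    IsMonomial a (n + k) (F * F') := by
  obtain ⟨c, m, hm, hn, h⟩ := hF
  obtain ⟨c', m', hm', hn', h'⟩ := hF'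
  refine ⟨c * c', fun b t => m b t + m' b t, fun g b t => by simp only [hm, hm'], fun b => ?_,
    fun b => ?_⟩
  · rw [Finset.sum_add_distrib]
    exact add_le_add (hn b) (hn' b)
  · simp only [map_mul, Pi.mul_apply, h, h', pow_add, Finset.prod_mul_distrib]
    ring

theorem IsMonomial.mono {F : (FP G R).obj B} (hF : IsMonomial a n F) (hkn : k ≤ n) :
    IsMonomial a k F := by
  obtain ⟨c, m, hm, hn, h⟩ := hF
  exact ⟨c, m, hm, fun b => hkn.trans (hn b), h⟩

theorem IsMonomial.res {F : (FP G R).obj X} (hF : IsMonomial a n F) (f : B →[G] X) :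
    IsMonomial a n ((FP G R).res f F) := by
  obtain ⟨c, m, hm, hn, h⟩ := hF
  refine ⟨(FP G R).res f c, fun b => m (f b), fun g b t => ?_, fun b => hn _, fun b => h _⟩
  simp only [map_smul, hm]

theorem IsMonomial.nm {F : (FP G R).obj B} (hF : IsMonomial a n F) (f : B →[G] X)
    (hf : Function.Surjective f) : IsMonomial a n ((FP G R).nm f F) := by
  classical
  obtain ⟨c, m, hm, hn, h⟩ := hF
  have := fun x => Fintype.ofFinite {b // f b = x}
  refine ⟨(FP G R).nm f c, fun x t => ∑ b : {b // f b = x}, m b t, fun g x t => ?_, fun x => ?_,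
    fun x => ?_⟩
  · symm
    exact Fintype.sum_equiv (FixedPointFunctor.fibreEquiv f g x) _ _ fun b => (hm g b t).symm
  · obtain ⟨b, hb⟩ := hf x
    refine (hn b).trans (Finset.sum_le_sum fun t _ => ?_)
    exact Finset.single_le_sum (f := fun b : {b // f b = x} => m b t) (fun _ _ => Nat.zero_le _)
      (Finset.mem_univ ⟨b, hb⟩)
  · rw [toFun_nm, toFun_nm, finprod_eq_prod_of_fintype, finprod_eq_prod_of_fintype]
    simp only [h, Finset.prod_mul_distrib, ← Finset.prod_pow_eq_pow_sum]
    rw [Finset.prod_comm (s := Finset.univ (α := T))]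

variable (a n X) in
/-- The elements of the `n`-th power of the ideal generated by `a` at a finite `G`-set: transfers
of monomials of degree at least `n`. -/
def IsTransferOfMonomial (y : (FP G R).obj X) : Prop :=
  ∃ (B : Type u) (_ : MulAction G B) (_ : Finite B) (f : B →[G] X) (F : (FP G R).obj B),
    IsMonomial a n F ∧ y = (FP G R).tr f F

namespace IsTransferOfMonomial

theorem zero : IsTransferOfMonomial a n X 0 := by
  let _ : MulAction G PEmpty.{u + 1} :=
    { smul := fun _ x => x, one_smul := fun _ => rfl, mul_smul := fun _ _ _ => rfl }
  exact ⟨PEmpty, inferInstance, inferInstance, ⟨PEmpty.elim, fun _ x => x.elim⟩, 0,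
    ⟨0, fun x => x.elim, fun _ x => x.elim, fun x => x.elim, fun x => x.elim⟩, (map_zero _).symm⟩

theorem add {y z : (FP G R).obj X} (hy : IsTransferOfMonomial a n X y)
    (hz : IsTransferOfMonomial a n X z) : IsTransferOfMonomial a n X (y + z) := by
  obtain ⟨B, _, _, f, F, ⟨c, m, hm, hn, h⟩, rfl⟩ := hy
  obtain ⟨B', _, _, f', F', ⟨c', m', hm', hn', h'⟩, rfl⟩ := hz
  have glue : ∀ (F : (FP G R).obj B) (F' : (FP G R).obj B'), ∃ F'' : (FP G R).obj (B ⊕ B'),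
      toFun _ F'' = Sum.elim (toFun _ F) (toFun _ F') := fun F F' =>
    exists_toFun_eq _ (by rintro g (b | b) <;> exact toFun_smul _ g b)
  obtain ⟨F₀, hF₀⟩ := glue F F'
  obtain ⟨c₀, hc₀⟩ := glue c c'
  refine ⟨B ⊕ B', inferInstance, inferInstance, sumElim f f', F₀,
    ⟨c₀, Sum.elim m m', ?_, ?_, ?_⟩, ?_⟩
  · rintro g (b | b) t
    · exact hm g b t
    · exact hm' g b t
  · rintro (b | b)
    · exact hn b
    · exact hn' b
  · rintro (b | b)
    · simpa only [hF₀, hc₀, Sum.elim_inl] using h b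
    · simpa only [hF₀, hc₀, Sum.elim_inr] using h' b
  · exact (tr_sumElim f f' F₀ F F' (fun x => by rw [hF₀]; rfl) (fun x => by rw [hF₀]; rfl)).symm

theorem mul_left {y : (FP G R).obj X} (hy : IsTransferOfMonomial a n X y) (r : (FP G R).obj X) :
    IsTransferOfMonomial a n X (r * y) := by
  obtain ⟨B, _, _, f, F, hF, rfl⟩ := hy
  exact ⟨B, _, ‹_›, f, _, hF.mul_left _, mul_tr f F r⟩

theorem tr {y : (FP G R).obj X} (hy : IsTransferOfMonomial a n X y) (f : X →[G] Y) :
    IsTransferOfMonomial a n Y ((FP G R).tr f y) := by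
  obtain ⟨B, _, _, h, F, hF, rfl⟩ := hy
  exact ⟨B, _, ‹_›, f.comp h, F, hF, ((FP G R).tr_comp f h F).symm⟩

theorem res {y : (FP G R).obj Y} (hy : IsTransferOfMonomial a n Y y) (f : X →[G] Y) :
    IsTransferOfMonomial a n X ((FP G R).res f y) := by
  obtain ⟨B, _, _, h, F, hF, rfl⟩ := hy
  exact ⟨equivariantPullback h f, _, inferInstance, _, _, hF.res _,
    (FP G R).res_tr _ _ _ _ (isPullbackSquare_equivariantPullback h f) F⟩

open scoped Pointwise in
theorem nm {y : (FP G R).obj X} (hy : IsTransferOfMonomial a n X y) (f : X →[G] Y)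
    (hf : Function.Surjective f) : IsTransferOfMonomial a n Y ((FP G R).nm f y) := by
  obtain ⟨B, _, _, h, F, hF, rfl⟩ := hy
  exact ⟨dependentProduct h f, _, inferInstance, _, _,
    (hF.res _).nm _ (dependentProduct.incidenceProj_surjective h f hf),
    (FP G R).nm_tr _ _ _ _ _ _ (dependentProduct.isExponentialDiagram h f) F⟩

theorem mul {y z : (FP G R).obj X} (hy : IsTransferOfMonomial a n X y)
    (hz : IsTransferOfMonomial a k X z) : IsTransferOfMonomial a (n + k) X (y * z) := by
  obtain ⟨B, _, _, f, F, hF, rfl⟩ := hy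
  obtain ⟨B', _, _, f', F', hF', rfl⟩ := hz
  rw [mul_tr, (FP G R).res_tr _ _ _ _ (isPullbackSquare_equivariantPullback f f'), mul_comm,
    mul_tr, ← (FP G R).tr_comp, mul_comm]
  exact ⟨_, _, inferInstance, _, _, (hF.res _).mul (hF'.res _), rfl⟩

theorem mono {y : (FP G R).obj X} (hy : IsTransferOfMonomial a n X y) (h : k ≤ n) :
    IsTransferOfMonomial a k X y := by
  obtain ⟨B, _, _, f, F, hF, rfl⟩ := hy
  exact ⟨B, _, ‹_›, f, F, hF.mono h, rfl⟩

end IsTransferOfMonomial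

theorem isTransferOfMonomial_self : IsTransferOfMonomial a 1 T a := by
  classical
  refine ⟨T, _, inferInstance, MulActionHom.id G, a, ⟨1, fun b t => if b = t then 1 else 0,
    fun g b t => by simp, fun b => by simp, fun b => by simp [pow_ite]⟩, ((FP G R).tr_id a).symm⟩

end Monomial

end FP

theorem orbitProj_surjective {G : Type u} [Group G] {K H : Subgroup G} (h : K ≤ H) :
    Function.Surjective (orbitProj h) := by
  intro x
  obtain ⟨g, rfl⟩ := QuotientGroup.mk_surjective x
  exact ⟨(g : G ⧸ K), rfl⟩

namespace TambaraIdeal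

variable {G : Type u} [Group G] [Finite G] {R : Type w} [CommRing R] [MulSemiringAction G R]
  {T : Type u} [MulAction G T] [Fintype T]

/-- The Tambara ideal of transfers of monomials of degree at least `n` in the values of `a`. -/
def monomialIdeal (a : (FP G R).obj T) (n : ℕ) : TambaraIdeal (FP G R) where
  level H :=
    { carrier := {y | FP.IsTransferOfMonomial a n (G ⧸ H) y}
      zero_mem' := .zero
      add_mem' := .add
      smul_mem' := fun r _ hy => hy.mul_left r }
  tr_mem _ _ ha := FP.IsTransferOfMonomial.tr ha _
  nm_mem h _ ha := FP.IsTransferOfMonomial.nm ha _ (orbitProj_surjective h)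
  res_mem _ _ ha := FP.IsTransferOfMonomial.res ha _
  conj_mem _ _ _ ha := FP.IsTransferOfMonomial.res ha _

theorem monomialIdeal_mul_le (a : (FP G R).obj T) {n k l : ℕ} (h : l ≤ n + k) :
    monomialIdeal a n * monomialIdeal a k ≤ monomialIdeal a l :=
  span_le.2 fun _ => SetLike.coe_subset_coe.2 <| Ideal.mul_le.2 fun _ hy _ hz =>
    (FP.IsTransferOfMonomial.mul hy hz).mono h

theorem mem_extend_of_isMonomial {P : TambaraIdeal (FP G R)} {a : (FP G R).obj T} {n : ℕ}
    (ha : a ^ n ∈ P.extend T) {B : Type u} [MulAction G B] [Finite B] {F : (FP G R).obj B}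
    (hF : FP.IsMonomial a (Fintype.card T * n + 1) F) : F ∈ P.extend B := by
  classical
  obtain ⟨c, m, hm, hn, h⟩ := hF
  let C : SubMulAction G (B × T) :=
    { carrier := {p | n ≤ m p.1 p.2}
      smul_mem' := fun g p hp => (hp : n ≤ m p.1 p.2).trans_eq (hm g p.1 p.2).symm }
  let v : C →[G] B := ⟨fun p => p.1.1, fun _ _ => rfl⟩
  let t : C →[G] T := ⟨fun p => p.1.2, fun _ _ => rfl⟩
  have hv : Function.Surjective v := by
    intro b
    by_contra! hb
    have hlt : ∀ t, m b t ≤ n := fun t => by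
      by_contra! ht
      exact hb ⟨(b, t), ht.le⟩ rfl
    have := (hn b).trans (Finset.sum_le_sum fun t _ => hlt t)
    simp at this
  obtain ⟨c', hc'⟩ := FP.exists_toFun_eq (G := G)
    (fun b => FP.toFun B c b * ∏ t, FP.toFun T a t ^ (m b t - if n ≤ m b t then n else 0))
    (fun g b => by
      rw [FP.toFun_smul, smul_mul', Finset.smul_prod']
      congr 1
      refine (Fintype.prod_equiv (MulAction.toPerm g) _ _ fun t => ?_).symm
      simp only [MulAction.toPerm_apply, hm, FP.toFun_smul, smul_pow'])
  have hFc : F = c' * (FP G R).nm v ((FP G R).res t (a ^ n)) := by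
    refine FP.ext fun b => ?_
    have h1 : FP.toFun B ((FP G R).nm v ((FP G R).res t (a ^ n))) b =
        ∏ t, FP.toFun T a t ^ (if n ≤ m b t then n else 0) := by
      rw [FP.toFun_nm]
      simp only [pow_ite, pow_zero]
      rw [← Finset.prod_filter, Finset.prod_subtype (p := fun t => n ≤ m b t) _ (by simp),
        ← finprod_eq_prod_of_fintype]
      refine finprod_eq_of_bijective (fun z : {z // v z = b} =>
        (⟨z.1.1.2, by obtain ⟨⟨z, hz⟩, rfl⟩ := z; exact hz⟩ : {t // n ≤ m b t})) ⟨?_, ?_⟩ ?_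
      · rintro ⟨⟨⟨b', s⟩, hs⟩, rfl⟩ ⟨⟨⟨b'', s'⟩, hs'⟩, hb⟩ hss
        have h2 : b'' = b' := hb
        have h3 : s = s' := congrArg Subtype.val hss
        subst h2 h3
        rfl
      · rintro ⟨s, hs⟩
        exact ⟨⟨⟨(b, s), hs⟩, rfl⟩, rfl⟩
      · intro z
        rw [FP.toFun_res, map_pow, Pi.pow_apply]
        rfl
    rw [map_mul, Pi.mul_apply, h1, hc', h, mul_assoc, ← Finset.prod_mul_distrib]
    congr 1
    refine Finset.prod_congr rfl fun t _ => ?_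
    rw [← pow_add]
    congr 1
    split_ifs <;> omega
  rw [hFc]
  exact Ideal.mul_mem_left _ _ (nm_mem_extend v hv (res_mem_extend t ha))

theorem IsPrime.mem_level_of_pow_mem {P : TambaraIdeal (FP G R)} (hP : P.IsPrime) {H : Subgroup G}
    {a : (FP G R).level H} {n : ℕ} (ha : a ^ n ∈ P.level H) : a ∈ P.level H := by
  have := Fintype.ofFinite (G ⧸ H)
  have key : ∀ k, monomialIdeal (T := G ⧸ H) a (1 + k) ≤ P → monomialIdeal (T := G ⧸ H) a 1 ≤ P := by
    intro k
    induction k with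
    | zero => exact id
    | succ k ih =>
      intro hk
      refine ih ?_
      exact (hP.2 _ _ ((monomialIdeal_mul_le a (by omega)).trans hk)).elim id id
  refine key (Fintype.card (G ⧸ H) * n) ?_ H FP.isTransferOfMonomial_self
  rintro K _ ⟨B, _, _, f, F, hF, rfl⟩
  rw [← extend_quotient] at ha ⊢
  rw [add_comm] at hF
  exact tr_mem_extend f (mem_extend_of_isMonomial ha hF)

end TambaraIdeal

/-! ## `G`-invariant ideals -/

section Invariant

variable {G : Type u} [Group G] {R : Type w} [CommRing R] [MulSemiringAction G R]

/-- The smallest invariant ideal that contains an element. -/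
def orbitIdeal (G : Type u) [Group G] {R : Type w} [CommRing R] [MulSemiringAction G R] (x : R) :
    Ideal R :=
  Ideal.span (Set.range fun g : G => g • x)

theorem mem_orbitIdeal_self (x : R) : x ∈ orbitIdeal G x :=
  Ideal.subset_span ⟨1, one_smul G x⟩

theorem smul_mem_orbitIdeal (x : R) (g : G) (y : R) (hy : y ∈ orbitIdeal G x) :
    g • y ∈ orbitIdeal G x := by
  refine Submodule.span_induction (p := fun y _ => g • y ∈ orbitIdeal G x) ?_ ?_ ?_ ?_ hy
  · rintro _ ⟨h, rfl⟩
    exact Ideal.subset_span ⟨g * h, mul_smul g h x⟩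
  · rw [smul_zero]
    exact zero_mem _
  · intro a b _ _ ha hb
    rw [smul_add]
    exact add_mem ha hb
  · intro a b _ hb
    rw [smul_eq_mul, smul_mul']
    exact Ideal.mul_mem_left _ _ hb

theorem orbitIdeal_mul_le {I : Ideal R} (hI : ∀ (g : G), ∀ x ∈ I, g • x ∈ I) {x y : R}
    (h : ∀ g : G, x * g • y ∈ I) : orbitIdeal G x * orbitIdeal G y ≤ I := by
  rw [orbitIdeal, orbitIdeal, Ideal.span_mul_span', Ideal.span_le]
  rintro _ ⟨_, ⟨g, rfl⟩, _, ⟨k, rfl⟩, rfl⟩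
  have h1 := hI g _ (h (g⁻¹ * k))
  rwa [smul_mul', smul_smul, mul_inv_cancel_left] at h1

namespace GPrimeSpectrum

theorem le_or_le (q : GPrimeSpectrum G R) {I J : Ideal R} (hJ : ∀ (g : G), ∀ x ∈ J, g • x ∈ J)
    (h : I * J ≤ q.ideal) : I ≤ q.ideal ∨ J ≤ q.ideal := by
  rw [or_iff_not_imp_left]
  intro hI y hy
  obtain ⟨x, hx, hxq⟩ := SetLike.not_le_iff_exists.1 hI
  exact (q.mem_or_mem x y fun g => h (Ideal.mul_mem_mul hx (hJ g y hy))).resolve_left hxq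

theorem le_of_pow_le (q : GPrimeSpectrum G R) {I : Ideal R} (hI : ∀ (g : G), ∀ x ∈ I, g • x ∈ I)
    {n : ℕ} (h : I ^ n ≤ q.ideal) : I ≤ q.ideal := by
  induction n with
  | zero =>
    rw [pow_zero, Ideal.one_eq_top, top_le_iff] at h
    exact absurd h q.ne_top
  | succ n ih =>
    rw [pow_succ] at h
    exact (q.le_or_le hI h).elim ih id

variable [Finite G]

theorem mem_of_pow_mem (q : GPrimeSpectrum G R) {x : R} {n : ℕ} (h : x ^ n ∈ q.ideal) :
    x ∈ q.ideal := by
  have hfg : (orbitIdeal G x).FG := ⟨(Set.finite_range fun g : G => g • x).toFinset, by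
    rw [Set.Finite.coe_toFinset]; rfl⟩
  have hle : orbitIdeal G x ≤ q.ideal.radical := by
    rw [orbitIdeal, Ideal.span_le]
    rintro _ ⟨g, rfl⟩
    refine ⟨n, ?_⟩
    change (g • x) ^ n ∈ _
    rw [← smul_pow']
    exact q.invariant g _ h
  obtain ⟨N, hN⟩ := Ideal.exists_pow_le_of_le_radical_of_fg hle hfg
  exact q.le_of_pow_le (smul_mem_orbitIdeal x) hN (mem_orbitIdeal_self x)

end GPrimeSpectrum

end Invariant

/-! ## Primes of the fixed-point functor -/

namespace FP

variable {G : Type u} [Group G] [Finite G] {R : Type w} [CommRing R] [MulSemiringAction G R]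

theorem toFun_apply_mk {H : Subgroup G} (a : (FP G R).level H) (g : G) :
    toFun (G ⧸ H) a (g : G ⧸ H) = g • toFun (G ⧸ H) a ((1 : G) : G ⧸ H) := by
  rw [← toFun_smul]
  refine congrArg (toFun (G ⧸ H) a) ?_
  change _ = ((g * 1 : G) : G ⧸ H)
  rw [mul_one]

theorem botEquiv_apply (a : (FP G R).level ⊥) :
    botEquiv G R a = toFun (G ⧸ (⊥ : Subgroup G)) a ((1 : G) : G ⧸ (⊥ : Subgroup G)) := rfl

theorem botEquiv_levelRes {H : Subgroup G} (a : (FP G R).level H) :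
    botEquiv G R ((FP G R).levelRes bot_le a) = toFun (G ⧸ H) a ((1 : G) : G ⧸ H) := rfl

theorem nm_levelRes {K H : Subgroup G} (h : K ≤ H) (a : (FP G R).level H) :
    (FP G R).levelNm h ((FP G R).levelRes h a) =
      a ^ Nat.card {t // orbitProj h t = ((1 : G) : G ⧸ H)} := by
  refine FP.ext fun y => ?_
  obtain ⟨g, rfl⟩ := QuotientGroup.mk_surjective y
  rw [toFun_apply_mk, toFun_apply_mk (a ^ _)]
  congr 1
  change ∏ᶠ x : {x // orbitProj h x = ((1 : G) : G ⧸ H)}, toFun (G ⧸ H) a (orbitProj h x) = _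
  have := Fintype.ofFinite {t // orbitProj h t = ((1 : G) : G ⧸ H)}
  rw [finprod_eq_prod_of_fintype, Finset.prod_congr rfl (fun x _ => by rw [x.2]),
    Finset.prod_const, map_pow, Pi.pow_apply, Nat.card_eq_fintype_card, Finset.card_univ]

end FP

namespace TambaraIdeal

variable {G : Type u} [Group G] [Finite G] {R : Type w} [CommRing R] [MulSemiringAction G R]

/-- The Tambara ideal `H ↦ I ∩ R^H` of an invariant ideal `I`. -/
noncomputable def ofInvariant (I : Ideal R) (_hI : ∀ (g : G), ∀ x ∈ I, g • x ∈ I) :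
    TambaraIdeal (FP G R) where
  level H := (Ideal.pi fun _ => I).comap (FP.toFun (G ⧸ H))
  tr_mem {K H} h a ha := by
    intro y
    rw [TambaraFunctor.levelTr, FP.toFun_tr]
    have := Fintype.ofFinite {x // orbitProj h x = y}
    rw [finsum_eq_sum_of_fintype]
    exact sum_mem fun x _ => ha x.1
  nm_mem {K H} h a ha := by
    intro y
    rw [TambaraFunctor.levelNm, FP.toFun_nm]
    have := Fintype.ofFinite {x // orbitProj h x = y}
    rw [finprod_eq_prod_of_fintype]
    obtain ⟨x, hx⟩ := orbitProj_surjective h y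
    exact Ideal.mem_of_dvd _ (Finset.dvd_prod_of_mem _ (Finset.mem_univ ⟨x, hx⟩)) (ha x)
  res_mem h a ha := fun x => ha _
  conj_mem g H a ha := fun x => ha _

variable {I : Ideal R} {hI : ∀ (g : G), ∀ x ∈ I, g • x ∈ I} {H : Subgroup G}

theorem mem_ofInvariant {a : (FP G R).level H} :
    a ∈ (ofInvariant I hI).level H ↔ FP.toFun (G ⧸ H) a ((1 : G) : G ⧸ H) ∈ I := by
  constructor
  · intro h
    exact h _
  · intro h x
    obtain ⟨g, rfl⟩ := QuotientGroup.mk_surjective x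
    rw [FP.toFun_apply_mk]
    exact hI g _ h

/-- The ideal `P(G/e)` of `R`. -/
noncomputable def bot (P : TambaraIdeal (FP G R)) : Ideal R := (P.level ⊥).map (FP.botEquiv G R)

theorem botEquiv_mem_bot {P : TambaraIdeal (FP G R)} {a : (FP G R).level ⊥} :
    FP.botEquiv G R a ∈ P.bot ↔ a ∈ P.level ⊥ := by
  rw [bot]
  exact Ideal.mem_map_of_equiv (FP.botEquiv G R) _ |>.trans
    ⟨fun ⟨b, hb, h⟩ => (FP.botEquiv G R).injective h ▸ hb, fun h => ⟨a, h, rfl⟩⟩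

theorem smul_mem_bot (P : TambaraIdeal (FP G R)) (g : G) (x : R) (hx : x ∈ P.bot) :
    g • x ∈ P.bot := by
  obtain ⟨a, rfl⟩ := (FP.botEquiv G R).surjective x
  rw [botEquiv_mem_bot, ← extend_quotient] at hx
  let f : (G ⧸ (⊥ : Subgroup G)) →[G] (G ⧸ (⊥ : Subgroup G)) :=
    (orbitConj g ⊥).comp (orbitProj bot_le)
  have h1 : FP.botEquiv G R ((FP G R).res f a) = g • FP.botEquiv G R a := by
    rw [FP.botEquiv_apply, FP.botEquiv_apply, FP.toFun_res, ← FP.toFun_apply_mk]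
    refine congrArg (FP.toFun _ a) ?_
    change ((1 * g : G) : G ⧸ (⊥ : Subgroup G)) = _
    rw [one_mul]
  rw [← h1, botEquiv_mem_bot, ← extend_quotient]
  exact res_mem_extend f hx

theorem bot_ofInvariant : (ofInvariant I hI).bot = I := by
  ext x
  obtain ⟨a, rfl⟩ := (FP.botEquiv G R).surjective x
  rw [botEquiv_mem_bot, mem_ofInvariant, FP.botEquiv_apply]

theorem le_ofInvariant_iff {P : TambaraIdeal (FP G R)} : P ≤ ofInvariant I hI ↔ P.bot ≤ I := by
  constructor
  · intro h x hx
    obtain ⟨a, rfl⟩ := (FP.botEquiv G R).surjective x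
    rw [botEquiv_mem_bot] at hx
    exact mem_ofInvariant.1 (h ⊥ hx)
  · intro h H a ha
    rw [mem_ofInvariant, ← FP.botEquiv_levelRes]
    exact h (botEquiv_mem_bot.2 (P.res_mem _ a ha))

theorem bot_mono {P Q : TambaraIdeal (FP G R)} (h : P ≤ Q) : P.bot ≤ Q.bot := Ideal.map_mono (h ⊥)

theorem IsPrime.eq_ofInvariant {P : TambaraIdeal (FP G R)} (hP : P.IsPrime) :
    P = ofInvariant P.bot P.smul_mem_bot := by
  refine le_antisymm (le_ofInvariant_iff.2 le_rfl) fun H a ha => ?_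
  rw [mem_ofInvariant, ← FP.botEquiv_levelRes, botEquiv_mem_bot] at ha
  have h1 := P.nm_mem (bot_le : ⊥ ≤ H) _ ha
  rw [FP.nm_levelRes] at h1
  exact hP.mem_level_of_pow_mem h1

theorem eq_top_of_bot_eq_top {P : TambaraIdeal (FP G R)} (h : P.bot = ⊤) : P = ⊤ := by
  refine le_antisymm (fun _ => le_top) fun H a _ => ?_
  have h1 : (1 : R) ∈ P.bot := h ▸ Submodule.mem_top
  rw [← map_one (FP.botEquiv G R), botEquiv_mem_bot] at h1
  have h2 := P.nm_mem (bot_le : ⊥ ≤ H) _ h1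
  rw [map_one] at h2
  exact (Ideal.eq_top_iff_one _).2 h2 ▸ Submodule.mem_top

theorem bot_mul_bot_le {P Q S : TambaraIdeal (FP G R)} (h : P * Q ≤ S) :
    P.bot * Q.bot ≤ S.bot := by
  rw [bot, bot, ← Ideal.map_mul]
  exact Ideal.map_mono (span_le.1 h ⊥)

theorem ofInvariant_mul_le {I J S : Ideal R} {hI : ∀ (g : G), ∀ x ∈ I, g • x ∈ I}
    {hJ : ∀ (g : G), ∀ x ∈ J, g • x ∈ J} {hS : ∀ (g : G), ∀ x ∈ S, g • x ∈ S} (h : I * J ≤ S) :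
    ofInvariant I hI * ofInvariant J hJ ≤ ofInvariant S hS := by
  refine span_le.2 fun H => SetLike.coe_subset_coe.2 (Ideal.mul_le.2 fun a ha b hb => ?_)
  rw [mem_ofInvariant] at ha hb ⊢
  rw [map_mul]
  exact h (Ideal.mul_mem_mul ha hb)

theorem isPrime_ofInvariant (q : GPrimeSpectrum G R) :
    (ofInvariant q.ideal q.invariant).IsPrime := by
  refine ⟨fun h => q.ne_top ?_, fun I J h => ?_⟩
  · rw [← bot_ofInvariant (hI := q.invariant), h, Ideal.eq_top_iff_one,
      ← map_one (FP.botEquiv G R), botEquiv_mem_bot]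
    exact Submodule.mem_top
  · rw [le_ofInvariant_iff, le_ofInvariant_iff]
    have h1 := bot_mul_bot_le h
    rw [bot_ofInvariant] at h1
    exact q.le_or_le J.smul_mem_bot h1

end TambaraIdeal

namespace NakaokaSpectrum

open TambaraIdeal

variable {G : Type u} [Group G] [Finite G] {R : Type w} [CommRing R] [MulSemiringAction G R]

/-- The `G`-prime ideal `P(G/e)` of a prime `P`. -/
noncomputable def botGPrime (P : NakaokaSpectrum (FP G R)) : GPrimeSpectrum G R where
  ideal := P.ideal.bot
  invariant := P.ideal.smul_mem_bot
  ne_top h := P.isPrime.1 (eq_top_of_bot_eq_top h)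
  mem_or_mem x y h := by
    have h1 := ofInvariant_mul_le (hI := smul_mem_orbitIdeal x) (hJ := smul_mem_orbitIdeal y)
      (hS := P.ideal.smul_mem_bot) (orbitIdeal_mul_le P.ideal.smul_mem_bot h)
    rw [← P.isPrime.eq_ofInvariant] at h1
    refine (P.isPrime.2 _ _ h1).imp (fun h2 => ?_) fun h2 => ?_
    · exact bot_mono h2 (by rw [bot_ofInvariant]; exact mem_orbitIdeal_self x)
    · exact bot_mono h2 (by rw [bot_ofInvariant]; exact mem_orbitIdeal_self y)

variable (G R) in
/-- Primes of the fixed-point functor are `G`-prime ideals. -/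
noncomputable def orderIsoGPrime : NakaokaSpectrum (FP G R) ≃o GPrimeSpectrum G R where
  toFun := botGPrime
  invFun q := ⟨ofInvariant q.ideal q.invariant, isPrime_ofInvariant q⟩
  left_inv P := NakaokaSpectrum.ext P.isPrime.eq_ofInvariant.symm
  right_inv q := GPrimeSpectrum.ext (bot_ofInvariant (hI := q.invariant))
  map_rel_iff' {P Q} := by
    change P.ideal.bot ≤ Q.ideal.bot ↔ P.ideal ≤ Q.ideal
    conv_rhs => rw [Q.isPrime.eq_ofInvariant]
    exact le_ofInvariant_iff.symm

theorem isClosed_iff {Z : Set (NakaokaSpectrum (FP G R))} : IsClosed Z ↔ ∃ I, zeroLocus I = Z := by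
  rw [← isOpen_compl_iff]
  change Zᶜᶜ ∈ Set.range zeroLocus ↔ _
  rw [compl_compl]
  rfl

end NakaokaSpectrum

/-! ## The spectrum of the fixed subring -/

section FixedSubring

variable {G : Type u} [Group G] {R : Type w} [CommRing R] [MulSemiringAction G R]

theorem mem_smul_asIdeal (g : G) (p : PrimeSpectrum R) (x : R) :
    x ∈ (g • p).asIdeal ↔ g⁻¹ • x ∈ p.asIdeal := Iff.rfl

theorem mem_iInf_smul {p : PrimeSpectrum R} {x : R} :
    x ∈ ⨅ g : G, (g • p).asIdeal ↔ ∀ g : G, g • x ∈ p.asIdeal := by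
  simp only [Submodule.mem_iInf, mem_smul_asIdeal]
  exact ⟨fun h g => by simpa using h g⁻¹, fun h g => h _⟩

theorem le_iInf_smul_iff {p : PrimeSpectrum R} {I : Ideal R}
    (hI : ∀ (g : G), ∀ x ∈ I, g • x ∈ I) : I ≤ ⨅ g : G, (g • p).asIdeal ↔ I ≤ p.asIdeal := by
  constructor
  · intro h x hx
    simpa using mem_iInf_smul.1 (h hx) 1
  · exact fun h x hx => mem_iInf_smul.2 fun g => h (hI g x hx)

/-- The `G`-prime ideal `⋂ g • p` of a prime ideal `p`. -/
def PrimeSpectrum.iInfSMul (G : Type u) [Group G] {R : Type w} [CommRing R]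
    [MulSemiringAction G R] (p : PrimeSpectrum R) : GPrimeSpectrum G R where
  ideal := ⨅ g : G, (g • p).asIdeal
  invariant g x hx := by
    rw [mem_iInf_smul] at hx ⊢
    intro k
    rw [smul_smul]
    exact hx _
  ne_top h := by
    have h1 : (1 : R) ∈ ⨅ g : G, (g • p).asIdeal := h ▸ Submodule.mem_top
    rw [mem_iInf_smul] at h1
    have h2 := h1 1
    rw [one_smul] at h2
    exact p.isPrime.ne_top ((Ideal.eq_top_iff_one _).2 h2)
  mem_or_mem x y h := by
    rw [mem_iInf_smul, mem_iInf_smul, or_iff_not_imp_left, not_forall]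
    rintro ⟨k, hk⟩ g
    have h1 := mem_iInf_smul.1 (h (k⁻¹ * g)) k
    rw [smul_mul', smul_smul, mul_inv_cancel_left] at h1
    exact (p.isPrime.mem_or_mem h1).resolve_left hk

namespace GPrimeSpectrum

/-- The prime ideal `q ∩ R^G` of a `G`-prime ideal `q`. -/
def contract (q : GPrimeSpectrum G R) : PrimeSpectrum (FixedPoints.subring R G) where
  asIdeal := q.ideal.comap (FixedPoints.subring R G).subtype
  isPrime := by
    refine ⟨fun h => q.ne_top ?_, fun {x y} h => ?_⟩
    · rw [Ideal.eq_top_iff_one] at h ⊢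
      exact h
    · refine q.mem_or_mem x y fun g => ?_
      rw [y.2 g]
      exact h

theorem contract_iInfSMul (p : PrimeSpectrum R) :
    (p.iInfSMul G).contract = PrimeSpectrum.comap (FixedPoints.subring R G).subtype p := by
  ext x
  refine (mem_iInf_smul (G := G) (p := p) (x := (x : R))).trans ⟨fun h => ?_, fun h g => ?_⟩
  · have := h 1
    rwa [one_smul] at this
  · rw [x.2 g]
    exact h

end GPrimeSpectrum

theorem SpecModG.continuous_mk : Continuous (SpecModG.mk G : PrimeSpectrum R → SpecModG G R) :=
  continuous_quotient_mk'

variable [Finite G]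

instance isInvariant_fixedPoints_subring : Algebra.IsInvariant (FixedPoints.subring R G) R G :=
  ⟨fun b hb => ⟨⟨b, hb⟩, rfl⟩⟩

theorem isIntegral_fixedPoints_subtype : (FixedPoints.subring R G).subtype.IsIntegral :=
  (Algebra.IsInvariant.isIntegral (FixedPoints.subring R G) R G).1

namespace GPrimeSpectrum

theorem le_of_comap_le {q q' : GPrimeSpectrum G R}
    (h : q.ideal.comap (FixedPoints.subring R G).subtype ≤
      q'.ideal.comap (FixedPoints.subring R G).subtype) : q.ideal ≤ q'.ideal := by
  classical
  intro x hx
  have := Fintype.ofFinite G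
  have hcoeff : ∀ i < Fintype.card G, (MulSemiringAction.charpoly G x).coeff i ∈ q'.ideal := by
    intro i hi
    refine h (x := ⟨_, fun g => MulSemiringAction.smul_coeff_charpoly x i g⟩) ?_
    change (MulSemiringAction.charpoly G x).coeff i ∈ q.ideal
    rw [← Ideal.Quotient.eq_zero_iff_mem, ← Polynomial.coeff_map,
      MulSemiringAction.charpoly_eq, Polynomial.map_prod]
    have h1 : ∀ g : G, (Polynomial.X - Polynomial.C (g • x)).map (Ideal.Quotient.mk q.ideal) =
        Polynomial.X := by
      intro g
      rw [Polynomial.map_sub, Polynomial.map_X, Polynomial.map_C,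
        Ideal.Quotient.eq_zero_iff_mem.2 (q.invariant g x hx), map_zero, sub_zero]
    rw [Finset.prod_congr rfl fun g _ => h1 g, Finset.prod_const, Finset.card_univ,
      Polynomial.coeff_X_pow, if_neg hi.ne]
  have hdeg : (MulSemiringAction.charpoly G x).natDegree ≤ Fintype.card G := by
    rw [MulSemiringAction.charpoly_eq]
    refine (Polynomial.natDegree_prod_le _ _).trans ?_
    refine (Finset.sum_le_sum fun g _ => Polynomial.natDegree_X_sub_C_le (g • x)).trans ?_
    simp
  have hlead : (MulSemiringAction.charpoly G x).coeff (Fintype.card G) = 1 := by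
    have h1 := Polynomial.coeff_prod_of_natDegree_le (s := Finset.univ)
      (fun g : G => Polynomial.X - Polynomial.C (g • x)) 1
      fun g _ => Polynomial.natDegree_X_sub_C_le _
    rw [Finset.card_univ, mul_one] at h1
    rw [MulSemiringAction.charpoly_eq, h1]
    simp [Polynomial.coeff_X]
  have h0 := MulSemiringAction.eval_charpoly (G := G) x
  rw [Polynomial.eval_eq_sum_range' (Nat.lt_succ_of_le hdeg), Finset.sum_range_succ, hlead,
    one_mul] at h0
  refine q'.mem_of_pow_mem (n := Fintype.card G) ?_
  rw [eq_neg_of_add_eq_zero_right h0]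
  exact neg_mem (sum_mem fun i hi => Ideal.mul_mem_right _ _ (hcoeff i (Finset.mem_range.1 hi)))

theorem exists_contract_eq (𝔭 : PrimeSpectrum (FixedPoints.subring R G)) :
    ∃ p : PrimeSpectrum R, (p.iInfSMul G).contract = 𝔭 := by
  obtain ⟨p, hp⟩ := isIntegral_fixedPoints_subtype.comap_surjective Subtype.val_injective 𝔭
  exact ⟨p, (contract_iInfSMul p).trans hp⟩

variable (G R) in
/-- `G`-prime ideals of `R` are prime ideals of `R^G`. -/
noncomputable def orderIsoFixed :
    GPrimeSpectrum G R ≃o PrimeSpectrum (FixedPoints.subring R G) :=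
  RelIso.ofSurjective
    (OrderEmbedding.ofMapLEIff contract fun _ _ => ⟨le_of_comap_le, fun h => Ideal.comap_mono h⟩)
    fun 𝔭 => (exists_contract_eq 𝔭).imp' (PrimeSpectrum.iInfSMul G) fun _ h => h

theorem exists_iInfSMul_eq (q : GPrimeSpectrum G R) : ∃ p : PrimeSpectrum R, p.iInfSMul G = q :=
  (exists_contract_eq q.contract).imp fun _ h => (orderIsoFixed G R).injective h

end GPrimeSpectrum

namespace SpecModG

variable (G R) in
/-- The map `[p] ↦ ⋂ g • p`. -/
def toGPrime (a : SpecModG G R) : GPrimeSpectrum G R :=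
  Quotient.lift (s := MulAction.orbitRel G (PrimeSpectrum R)) (PrimeSpectrum.iInfSMul G) (by
    rintro _ p ⟨g, rfl⟩
    refine GPrimeSpectrum.ext (Ideal.ext fun x => ?_)
    refine mem_iInf_smul.trans (Iff.trans ?_ mem_iInf_smul.symm)
    simp only [mem_smul_asIdeal, smul_smul]
    exact ⟨fun h k => by simpa using h (g * k), fun h k => h _⟩) a

theorem toGPrime_le_iff {a b : SpecModG G R} : toGPrime G R a ≤ toGPrime G R b ↔ a ≤ b := by
  classical
  constructor
  · obtain ⟨p, rfl⟩ := Quotient.exists_rep a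
    obtain ⟨q, rfl⟩ := Quotient.exists_rep b
    intro h
    have h1 : ⨅ g : G, (g • p).asIdeal ≤ q.asIdeal :=
      (le_iInf_smul_iff (p.iInfSMul G).invariant).1 h
    have := Fintype.ofFinite G
    rw [← Finset.inf_univ_eq_iInf, q.isPrime.inf_le'] at h1
    obtain ⟨g, -, hg⟩ := h1
    exact ⟨g • p, q, Quotient.sound ⟨g, rfl⟩, rfl, hg⟩
  · rintro ⟨p, q, rfl, rfl, h⟩
    exact fun x hx => mem_iInf_smul.2 fun g => h (mem_iInf_smul.1 hx g)

variable (G R) in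
/-- Orbits of primes are `G`-prime ideals. -/
noncomputable def orderIsoGPrime : SpecModG G R ≃o GPrimeSpectrum G R :=
  RelIso.ofSurjective (OrderEmbedding.ofMapLEIff (toGPrime G R) fun _ _ => toGPrime_le_iff)
    fun q => (GPrimeSpectrum.exists_iInfSMul_eq q).imp' (SpecModG.mk G) fun _ h => h

variable (G R) in
/-- Orbits of primes are primes of the fixed subring. -/
noncomputable def orderIsoFixed : SpecModG G R ≃o PrimeSpectrum (FixedPoints.subring R G) :=
  (orderIsoGPrime G R).trans (GPrimeSpectrum.orderIsoFixed G R)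

theorem orderIsoFixed_mk (p : PrimeSpectrum R) :
    orderIsoFixed G R (mk G p) = PrimeSpectrum.comap (FixedPoints.subring R G).subtype p :=
  GPrimeSpectrum.contract_iInfSMul p

variable (G R) in
/-- The homeomorphism `Spec(R)/G ≅ Spec(R^G)`. -/
noncomputable def homeomorphFixed : SpecModG G R ≃ₜ PrimeSpectrum (FixedPoints.subring R G) :=
  (orderIsoFixed G R).toEquiv.toHomeomorphOfContinuousClosed
    (isQuotientMap_quotient_mk'.continuous_iff.2 <|
      (PrimeSpectrum.continuous_comap (FixedPoints.subring R G).subtype).congr fun p =>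
        (orderIsoFixed_mk p).symm)
    (by
      intro Z hZ
      have h1 : (orderIsoFixed G R).toEquiv '' Z =
          PrimeSpectrum.comap (FixedPoints.subring R G).subtype '' (SpecModG.mk G ⁻¹' Z) := by
        ext 𝔭
        constructor
        · rintro ⟨a, ha, rfl⟩
          obtain ⟨p, rfl⟩ := Quotient.exists_rep a
          exact ⟨p, ha, (orderIsoFixed_mk p).symm⟩
        · rintro ⟨p, hp, rfl⟩
          exact ⟨_, hp, orderIsoFixed_mk p⟩
      rw [h1]
      exact PrimeSpectrum.isClosedMap_comap_of_isIntegral _ isIntegral_fixedPoints_subtype _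
        (hZ.preimage continuous_mk))

end SpecModG

namespace NakaokaSpectrum

open TambaraIdeal

theorem mem_level_iff (P : NakaokaSpectrum (FP G R)) {H : Subgroup G} {a : (FP G R).level H} :
    a ∈ P.ideal.level H ↔ FP.toFun (G ⧸ H) a ((1 : G) : G ⧸ H) ∈ P.ideal.bot := by
  conv_lhs => rw [P.isPrime.eq_ofInvariant]
  exact mem_ofInvariant

variable (G R) in
/-- Primes of the fixed-point functor are primes of the fixed subring. -/
noncomputable def orderIsoFixed :
    NakaokaSpectrum (FP G R) ≃o PrimeSpectrum (FixedPoints.subring R G) :=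
  (orderIsoGPrime G R).trans (GPrimeSpectrum.orderIsoFixed G R)

theorem asIdeal_orderIsoFixed (P : NakaokaSpectrum (FP G R)) :
    (orderIsoFixed G R P).asIdeal = (P.ideal.level ⊤).map (FP.topEquiv G R) := by
  ext x
  obtain ⟨a, rfl⟩ := (FP.topEquiv G R).surjective x
  refine (P.mem_level_iff (a := a)).symm.trans ?_
  refine Iff.symm ((Ideal.mem_map_of_equiv (FP.topEquiv G R) _).trans
    ⟨fun ⟨b, hb, h⟩ => (FP.topEquiv G R).injective h ▸ hb, fun h => ⟨a, h, rfl⟩⟩)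

theorem continuous_orderIsoFixed : Continuous (orderIsoFixed G R) := by
  rw [continuous_iff_isClosed]
  intro Z hZ
  obtain ⟨s, rfl⟩ := (PrimeSpectrum.isClosed_iff_zeroLocus Z).1 hZ
  refine isClosed_iff.2 ⟨span fun H =>
    {a | FP.toFun (G ⧸ H) a ((1 : G) : G ⧸ H) ∈ (Subtype.val '' s : Set R)}, ?_⟩
  ext P
  refine span_le.trans ⟨fun h r hr => ?_, fun h H a ha => ?_⟩
  · obtain ⟨a, rfl⟩ := (FP.topEquiv G R).surjective r
    exact P.mem_level_iff.1 (h ⊤ (show a ∈ _ from ⟨_, hr, rfl⟩))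
  · obtain ⟨r, hr, hra⟩ := ha
    rw [SetLike.mem_coe, mem_level_iff, ← hra]
    exact h hr

theorem isClosedMap_orderIsoFixed : IsClosedMap (orderIsoFixed G R) := by
  intro Z hZ
  obtain ⟨I, rfl⟩ := isClosed_iff.1 hZ
  have h1 : orderIsoFixed G R '' zeroLocus I = PrimeSpectrum.comap
      (FixedPoints.subring R G).subtype '' PrimeSpectrum.zeroLocus I.bot := by
    ext 𝔭
    constructor
    · rintro ⟨P, hP, rfl⟩
      obtain ⟨p, hp⟩ := P.botGPrime.exists_iInfSMul_eq
      refine ⟨p, ?_, ?_⟩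
      · refine (le_iInf_smul_iff (G := G) I.smul_mem_bot).1 ?_
        have h2 : ⨅ g : G, (g • p).asIdeal = P.ideal.bot := congrArg GPrimeSpectrum.ideal hp
        rw [h2]
        exact bot_mono hP
      · rw [← GPrimeSpectrum.contract_iInfSMul (G := G), hp]
        rfl
    · rintro ⟨p, hp, rfl⟩
      refine ⟨(orderIsoGPrime G R).symm (p.iInfSMul G), ?_, ?_⟩
      · exact (le_ofInvariant_iff (hI := (p.iInfSMul G).invariant)).2
          ((le_iInf_smul_iff I.smul_mem_bot).2 hp)
      · rw [orderIsoFixed, OrderIso.trans_apply, OrderIso.apply_symm_apply,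
          ← GPrimeSpectrum.contract_iInfSMul (G := G)]
        rfl
  rw [h1]
  exact PrimeSpectrum.isClosedMap_comap_of_isIntegral _ isIntegral_fixedPoints_subtype _
    (PrimeSpectrum.isClosed_zeroLocus _)

variable (G R) in
/-- The homeomorphism `Spec(FP(R)) ≅ Spec(R^G)`. -/
noncomputable def homeomorphFixed :
    NakaokaSpectrum (FP G R) ≃ₜ PrimeSpectrum (FixedPoints.subring R G) :=
  (orderIsoFixed G R).toEquiv.toHomeomorphOfContinuousClosed continuous_orderIsoFixed
    isClosedMap_orderIsoFixed

end NakaokaSpectrum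

end FixedSubring

/-! ## Naturality -/

section Naturality

variable {G : Type u} [Group G] {R S : Type w} [CommRing R] [MulSemiringAction G R] [CommRing S]
  [MulSemiringAction G S] (f : R →+*[G] S)

/-- The preimage of a `G`-prime ideal along an equivariant ring homomorphism. -/
def GPrimeSpectrum.comap (q : GPrimeSpectrum G S) : GPrimeSpectrum G R where
  ideal := q.ideal.comap (f : R →+* S)
  invariant g x hx := by
    change f (g • x) ∈ q.ideal
    rw [map_smul]
    exact q.invariant g _ hx
  ne_top h := q.ne_top (by
    rw [Ideal.eq_top_iff_one] at h ⊢
    have h1 : f 1 ∈ q.ideal := h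
    rwa [map_one] at h1)
  mem_or_mem x y h := q.mem_or_mem (f x) (f y) fun g => by
    rw [← map_smul, ← map_mul]
    exact h g

variable [Finite G]

/-- The levelwise preimage of a prime along an equivariant ring homomorphism. -/
noncomputable def NakaokaSpectrum.comap (P : NakaokaSpectrum (FP G S)) :
    NakaokaSpectrum (FP G R) :=
  (orderIsoGPrime G R).symm (P.botGPrime.comap f)

theorem NakaokaSpectrum.level_comap (P : NakaokaSpectrum (FP G S)) (H : Subgroup G) :
    (P.comap f).ideal.level H = (P.ideal.level H).comap (FP.map f (G ⧸ H)) := by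
  ext a
  exact (TambaraIdeal.mem_ofInvariant (hI := (P.botGPrime.comap f).invariant)).trans
    (P.mem_level_iff (a := FP.map f (G ⧸ H) a)).symm

theorem NakaokaSpectrum.orderIsoFixed_comap (P : NakaokaSpectrum (FP G S)) :
    orderIsoFixed G R (P.comap f) = PrimeSpectrum.comap (fixedRingHom f) (orderIsoFixed G S P) := by
  rw [orderIsoFixed, OrderIso.trans_apply, comap, OrderIso.apply_symm_apply]
  rfl

theorem NakaokaSpectrum.continuous_comap :
    Continuous fun P : NakaokaSpectrum (FP G S) => P.comap f := by
  rw [← (NakaokaSpectrum.homeomorphFixed G R).comp_continuous_iff]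
  exact ((PrimeSpectrum.continuous_comap (fixedRingHom f)).comp continuous_orderIsoFixed).congr
    fun P => (orderIsoFixed_comap f P).symm

end Naturality

theorem theoremB (G : Type u) [Group G] [Finite G] :
    ∃ (α : ∀ (R : Type w) [CommRing R] [MulSemiringAction G R],
          NakaokaSpectrum (FP G R) ≃ₜ PrimeSpectrum (FixedPoints.subring R G))
      (γ : ∀ (R : Type w) [CommRing R] [MulSemiringAction G R],
          SpecModG G R ≃ₜ PrimeSpectrum (FixedPoints.subring R G)),
      -- the homeomorphisms are given by `P ↦ P(G/G)` and `[p] ↦ p ∩ R^G`,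
      -- and they come from isomorphisms of posets
      (∀ (R : Type w) [CommRing R] [MulSemiringAction G R],
        (∀ P, (α R P).asIdeal = (P.ideal.level ⊤).map (FP.topEquiv G R)) ∧
        (∀ p : PrimeSpectrum R,
          γ R (SpecModG.mk G p) = PrimeSpectrum.comap (FixedPoints.subring R G).subtype p) ∧
        ∃ (φ : SpecModG G R ≃o GPrimeSpectrum G R)
          (ψ : GPrimeSpectrum G R ≃o PrimeSpectrum (FixedPoints.subring R G))
          (δ : NakaokaSpectrum (FP G R) ≃o GPrimeSpectrum G R),
          (∀ p : PrimeSpectrum R, (φ (SpecModG.mk G p)).ideal = ⨅ g : G, (g • p).asIdeal) ∧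
          (∀ q, (ψ q).asIdeal = q.ideal.comap (FixedPoints.subring R G).subtype) ∧
          (∀ P, (δ P).ideal = (P.ideal.level ⊥).map (FP.botEquiv G R)) ∧
          (∀ P, α R P = ψ (δ P)) ∧
          (∀ a, γ R a = ψ (φ a))) ∧
      -- naturality of the homeomorphisms in the ring with `G`-action
      (∀ (R S : Type w) [CommRing R] [MulSemiringAction G R] [CommRing S] [MulSemiringAction G S]
        (f : R →+*[G] S),
        (∃ F : C(NakaokaSpectrum (FP G S), NakaokaSpectrum (FP G R)),
          (∀ P H, (F P).ideal.level H = (P.ideal.level H).comap (FP.map f (G ⧸ H))) ∧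
          ∀ P, α R (F P) = PrimeSpectrum.comap (fixedRingHom f) (α S P)) ∧
        ∀ p : PrimeSpectrum S, γ R (SpecModG.mk G (PrimeSpectrum.comap (f : R →+* S) p)) =
          PrimeSpectrum.comap (fixedRingHom f) (γ S (SpecModG.mk G p))) := by
  refine ⟨fun R _ _ => NakaokaSpectrum.homeomorphFixed G R,
    fun R _ _ => SpecModG.homeomorphFixed G R,
    fun R _ _ => ⟨NakaokaSpectrum.asIdeal_orderIsoFixed, SpecModG.orderIsoFixed_mk,
      SpecModG.orderIsoGPrime G R, GPrimeSpectrum.orderIsoFixed G R,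
      NakaokaSpectrum.orderIsoGPrime G R, fun _ => rfl, fun _ => rfl, fun _ => rfl, fun _ => rfl,
      fun _ => rfl⟩,
    fun R S _ _ _ _ f => ⟨⟨⟨NakaokaSpectrum.comap f, NakaokaSpectrum.continuous_comap f⟩,
      NakaokaSpectrum.level_comap f, NakaokaSpectrum.orderIsoFixed_comap f⟩, fun p =>
      (SpecModG.orderIsoFixed_mk _).trans
        (congrArg (PrimeSpectrum.comap (fixedRingHom f)) (SpecModG.orderIsoFixed_mk p).symm)⟩⟩
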